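/- Consider the linear time-invariant system $x_{t+1}=Ax_t+Bu_t+w_t$, $y_t=Cx_t+Du_t+v_t$, $x_0=0$, with $x_t,w_t\in\mathbb R^n$, $u_t\in\mathbb R^p$, $y_t,v_t\in\mathbb R^m$ ($n,p,m\ge 1$). For a matrix $M$ let $\|M\|_\infty=\max_i\sum_j|M_{ij}|$ be the largest $\ell_1$-norm of a row, $\|M\|_{2,\infty}$ the supremum of the $\ell_2$-norms of the rows, $\|M\|_{1,1}$ the sum of the absolute values of the entries, and $\|M\|_F$ the Frobenius norm; write $\log^+x=\max\{0,\log x\}$ for $x>0$ and $\log^+0=0$. Suppose that $C_{\mathrm{sys}}\ge1$ and $\rho<1$ satisfy $\|A^\tau\|_\infty\le C_{\mathrm{sys}}\rho^\tau$ for every integer $\tau\ge0$ and $\max\{\|B\|_\infty,\|C\|_\infty,\|D\|_\infty\}\le C_{\mathrm{sys}}$. Let $T,N\ge1$. For $t=0,\dots,T+N-2$ let $u_t\sim\mathcal N(0,\sigma_u^2I)$ with $\sigma_u>0$, let the entries of $w_t$ and of $v_t$ be centred sub-Gaussian with parameters $\sigma_w\ge0$ and $\sigma_v\ge0$ respectively,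 and let all the entries of all $u_t,w_t,v_t$ be independent. Put $\bar\sigma_w=\frac{C_{\mathrm{sys}}^2}{1-\rho}\sigma_w$, $\bar u_t=[u_t^\top\ u_{t-1}^\top\ \cdots\ u_{t-T+1}^\top]^\top$, and let $$\widehat G=[\widehat D\ \widehat G_0\ \cdots\ \widehat G_{T-2}]\in\arg\min_{X\in\mathbb R^{m\times Tp}}\ \frac1{2N}\sum_{t=T-1}^{N+T-2}\|y_t-X\bar u_t\|_2^2+\lambda\|X\|_{1,1}.$$ For $\epsilon,\tilde\epsilon>0$ put $$T_0=\frac{\log\log(Nn+Tp)+\log\frac{C_{\mathrm{sys}}}{1-\rho}+\log^+(\sigma_w+\sigma_v)+\log^+\frac1\epsilon}{1-\rho},\qquad \Lambda=\sigma_u(\bar\sigma_w+\sigma_v)\sqrt{\frac{\log(Tpn)}N}+\epsilon,$$ $$\mathcal E_1=\sqrt{\frac{C_{\mathrm{sys}}^3}{1-\rho}}\left(\sqrt{\frac{\bar\sigma_w+\sigma_v}{\sigma_u^3}}\Big(\frac{\log(Tpn)}N\Big)^{1/4}+\frac{\sqrt\epsilon}{\sigma_u^2}\right),\qquad \mathcal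 E_2=\frac{C_{\mathrm{sys}}^3}{1-\rho}\Big(\frac{\log(Tp)}N\Big)^{1/4}.$$ For $T\le K\le\infty$ let $M_0=D$, $M_k=CA^{k-1}B$ $(k\ge1)$, and $\widehat M_0=\widehat D$, $\widehat M_k=\widehat G_{k-1}$ $(1\le k\le T-1)$, $\widehat M_k=0$ $(k\ge T)$. Let $G^{(K)}=[M_0\ M_1\ \cdots\ M_{K-1}]$ and $\widehat G^{(K)}=[\widehat M_0\ \widehat M_1\ \cdots\ \widehat M_{K-1}]$ be the true and estimated $K$-th order Markov parameters, and let $H^{(K)}=(M_{k+l})_{0\le k,l<K}$ and $\widehat H^{(K)}=(\widehat M_{k+l})_{0\le k,l<K}$ be the true and estimated $K$-th order block Hankel matrices. For every $\eta>0$ and every $S>0$ there are constants $c_1,c_2,c_3>0$, depending only on $\eta$ and $S$, such that for every $c_4\ge c_3$ there is a constant $c_5>0$, depending only on $\eta,S,c_4$, with the following property. If, in the above setting, $\sigma_u\le S$ and $$N\ge c_1\log^2(Tp),\qquad T\ge c_2\left(T_0\vee\frac{\log\|C\|_\infty+\log(1/\tilde\epsilon)}{1-\rho}\right),\qquad c_3\Lambda\le\lambda\le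 c_4\Lambda$$ (with $\log 0=-\infty$ in the second condition), then with probability at least $1-m(Tp)^{-\eta}$, for every minimizer $\widehat G$ and simultaneously for all $K$ with $T\le K\le\infty$, $$\|G^{(K)}-\widehat G^{(K)}\|_{2,\infty}\le c_5(\mathcal E_1\vee\mathcal E_2+\tilde\epsilon),\qquad \|G^{(K)}-\widehat G^{(K)}\|_F\le c_5\sqrt m\,(\mathcal E_1\vee\mathcal E_2+\tilde\epsilon),$$ $$\|H^{(K)}-\widehat H^{(K)}\|_{2,\infty}\le c_5(\mathcal E_1\vee\mathcal E_2+\tilde\epsilon),\qquad \|H^{(K)}-\widehat H^{(K)}\|_F\le c_5\sqrt{Tm}\,(\mathcal E_1\vee\mathcal E_2+\tilde\epsilon).$$ -/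

import Mathlib

open MeasureTheory ProbabilityTheory
open scoped ENNReal NNReal Matrix

noncomputable section

namespace LTI

/-- The matrices of the system `x_{t+1} = A x_t + B u_t + w_t`, `y_t = C x_t + D u_t + v_t`
with `n` states, `p` inputs and `m` outputs. -/
structure LinSys (n p m : ℕ) where
  A : Matrix (Fin n) (Fin n) ℝ
  B : Matrix (Fin n) (Fin p) ℝ
  C : Matrix (Fin m) (Fin n) ℝ
  D : Matrix (Fin m) (Fin p) ℝ

variable {n p m : ℕ}

/-- The state trajectory started at `x_0 = 0`. -/
def LinSys.state (sys : LinSys n p m) (u : ℕ → Fin p → ℝ) (w : ℕ → Fin n → ℝ) : ℕ → Fin n → ℝ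
  | 0 => 0
  | t + 1 => sys.A *ᵥ LinSys.state sys u w t + sys.B *ᵥ u t + w t

/-- The output trajectory. -/
def LinSys.output (sys : LinSys n p m) (u : ℕ → Fin p → ℝ) (w : ℕ → Fin n → ℝ)
    (v : ℕ → Fin m → ℝ) (t : ℕ) : Fin m → ℝ :=
  sys.C *ᵥ sys.state u w t + sys.D *ᵥ u t + v t

/-- The blocks `D, CB, CAB, CA²B, …`. -/
def LinSys.markov (sys : LinSys n p m) : ℕ → Matrix (Fin m) (Fin p) ℝ
  | 0 => sys.D
  | k + 1 => sys.C * sys.A ^ k * sys.B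

/-- The largest `ℓ¹` norm of a row (the operator norm for the sup norm on column vectors, and
for the `ℓ¹` norm on row vectors). -/
def maxRowSum {r s : ℕ} (M : Matrix (Fin r) (Fin s) ℝ) : ℝ :=
  ⨆ i, ∑ j, |M i j|

/-- Stability and boundedness: `‖A^τ‖ ≤ c ρ^τ` for all `τ ≥ 0`, and `B`, `C`, `D` are bounded
by `c`, in the norm `maxRowSum`, where `c ≥ 1` and `ρ < 1`. -/
structure LinSys.IsStable (sys : LinSys n p m) (c ρ : ℝ) : Prop where
  one_le : 1 ≤ c
  lt_one : ρ < 1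
  norm_pow_A : ∀ τ : ℕ, maxRowSum (sys.A ^ τ) ≤ c * ρ ^ τ
  norm_B : maxRowSum sys.B ≤ c
  norm_C : maxRowSum sys.C ≤ c
  norm_D : maxRowSum sys.D ≤ c

/-- The probabilistic model over the time steps `0, …, L - 1`: the inputs are `N(0, σu² I)`, the
entries of the process noise `w` and of the measurement noise `v` are (centred) sub-Gaussian with
parameters `σw` and `σv`, and all entries of all inputs and noises at all times are independent. -/
structure IsNoiseModel {Ω : Type*} [MeasurableSpace Ω] (μ : Measure Ω) (L : ℕ)
    (u : ℕ → Ω → Fin p → ℝ) (w : ℕ → Ω → Fin n → ℝ) (v : ℕ → Ω → Fin m → ℝ)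
    (σu σw σv : ℝ≥0) : Prop where
  input_law : ∀ t < L, ∀ j, HasLaw (fun ω => u t ω j) (gaussianReal 0 (σu ^ 2)) μ
  process_subgaussian : ∀ t < L, ∀ i, HasSubgaussianMGF (fun ω => w t ω i) (σw ^ 2) μ
  measurement_subgaussian : ∀ t < L, ∀ i, HasSubgaussianMGF (fun ω => v t ω i) (σv ^ 2) μ
  indep : iIndepFun
    (fun (s : (Fin L × Fin p) ⊕ (Fin L × Fin n) ⊕ (Fin L × Fin m)) (ω : Ω) =>
      match s with
      | .inl (t, j) => u t ω j
      | .inr (.inl (t, i)) => w t ω i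
      | .inr (.inr (t, i)) => v t ω i) μ

/-- The stacked input `ū_t = (u_t, u_{t-1}, …, u_{t-T+1})` (used only for `t ≥ T - 1`). -/
def stackedInput (T : ℕ) (u : ℕ → Fin p → ℝ) (t : ℕ) : Fin T × Fin p → ℝ :=
  fun kj => u (t - kj.1) kj.2

/-- The objective
`(1 / 2N) ∑_{t = T-1}^{N+T-2} ‖y_t - X ū_t‖₂² + lam ‖X‖_{1,1}`. -/
def lassoObjective (T N : ℕ) (lam : ℝ) (u : ℕ → Fin p → ℝ) (y : ℕ → Fin m → ℝ)
    (X : Matrix (Fin m) (Fin T × Fin p) ℝ) : ℝ :=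
  1 / (2 * (N : ℝ)) *
      ∑ t ∈ Finset.Icc (T - 1) (N + T - 2), ∑ i, (y t i - (X *ᵥ stackedInput T u t) i) ^ 2
    + lam * ∑ i, ∑ kj, |X i kj|

/-- `X` is an `ℓ¹`-regularized least-squares estimate of the Markov matrix. -/
def IsLassoEstimate (T N : ℕ) (lam : ℝ) (u : ℕ → Fin p → ℝ) (y : ℕ → Fin m → ℝ)
    (X : Matrix (Fin m) (Fin T × Fin p) ℝ) : Prop :=
  ∀ X', lassoObjective T N lam u y X ≤ lassoObjective T N lam u y X'

/-- The blocks `D̂, Ĝ₀, …, Ĝ_{T-2}, 0, 0, …` of an estimate, padded by zeros. -/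
def estimatedMarkov {T : ℕ} (X : Matrix (Fin m) (Fin T × Fin p) ℝ) (k : ℕ) :
    Matrix (Fin m) (Fin p) ℝ :=
  fun i j => if h : k < T then X i (⟨k, h⟩, j) else 0

/-- Block positions `0, 1, …, K - 1`, where `K` may be infinite. -/
abbrev BlockIdx (K : ℕ∞) : Type := {k : ℕ // (k : ℕ∞) < K}

/-- The matrix `[M₀ M₁ … M_{K-1}]`. -/
def blockRow (K : ℕ∞) (M : ℕ → Matrix (Fin m) (Fin p) ℝ) :
    Matrix (Fin m) (BlockIdx K × Fin p) ℝ :=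
  fun i kj => M kj.1 i kj.2

/-- The block Hankel matrix whose block in position `(k, l)`, `0 ≤ k, l < K`, is `M_{k+l}`. -/
def blockHankel (K : ℕ∞) (M : ℕ → Matrix (Fin m) (Fin p) ℝ) :
    Matrix (BlockIdx K × Fin m) (BlockIdx K × Fin p) ℝ :=
  fun ki lj => M (ki.1 + lj.1) ki.2 lj.2

/-- The `ℓ²` norm of a finite or infinite vector, possibly `∞`. -/
def l2Norm {ι : Type*} (x : ι → ℝ) : ℝ≥0∞ :=
  (∑' j, ‖x j‖ₑ ^ 2) ^ (1 / 2 : ℝ)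

/-- `‖M‖_{2,∞}`: the supremum of the `ℓ²` norms of the rows. -/
def norm2Inf {ι κ : Type*} (M : Matrix ι κ ℝ) : ℝ≥0∞ :=
  ⨆ i, l2Norm (M i)

/-- The Frobenius norm `‖M‖_F = ‖M‖_{2,2}`. -/
def normFrob {ι κ : Type*} (M : Matrix ι κ ℝ) : ℝ≥0∞ :=
  (∑' i, l2Norm (M i) ^ 2) ^ (1 / 2 : ℝ)

/-- The effective standard deviation `σ̄w = (c² / (1 - ρ)) σw` of the process noise. -/
def effNoise (c ρ σw : ℝ) : ℝ := c ^ 2 / (1 - ρ) * σw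

/-- The lower bound `T₀` (up to a constant) for `T`. -/
def T₀ (n p T N : ℕ) (c ρ σw σv ε : ℝ) : ℝ :=
  (Real.log (Real.log (N * n + T * p)) + Real.log (c / (1 - ρ))
    + Real.posLog (σw + σv) + Real.posLog (1 / ε)) / (1 - ρ)

/-- The order of magnitude of the regularization parameter. -/
def lambdaScale (n p T N : ℕ) (c ρ σu σw σv ε : ℝ) : ℝ :=
  σu * (effNoise c ρ σw + σv) * √(Real.log (T * p * n) / N) + ε

def err₁ (n p T N : ℕ) (c ρ σu σw σv ε : ℝ) : ℝ :=
  √(c ^ 3 / (1 - ρ)) *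
    (√((effNoise c ρ σw + σv) / σu ^ 3) * (Real.log (T * p * n) / N) ^ (1 / 4 : ℝ)
      + √ε / σu ^ 2)

def err₂ (p T N : ℕ) (c ρ : ℝ) : ℝ :=
  c ^ 3 / (1 - ρ) * (Real.log (T * p) / N) ^ (1 / 4 : ℝ)

/-- The four error bounds, for an estimate `X` and order `K`, with right-hand sides `b`, `√m b`,
`b` and `√(Tm) b`. -/
structure ErrorBounds {T : ℕ} (sys : LinSys n p m) (X : Matrix (Fin m) (Fin T × Fin p) ℝ)
    (K : ℕ∞) (b : ℝ) : Prop where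
  markov_row : norm2Inf (blockRow K sys.markov - blockRow K (estimatedMarkov X))
    ≤ ENNReal.ofReal b
  markov_frob : normFrob (blockRow K sys.markov - blockRow K (estimatedMarkov X))
    ≤ ENNReal.ofReal (√m * b)
  hankel_row : norm2Inf (blockHankel K sys.markov - blockHankel K (estimatedMarkov X))
    ≤ ENNReal.ofReal b
  hankel_frob : normFrob (blockHankel K sys.markov - blockHankel K (estimatedMarkov X))
    ≤ ENNReal.ofReal (√(T * m) * b)

end LTI

end

open LTI

/-!
The proof is the slow-rate analysis of the lasso, applied to each output separately. The regression
of `y_t` on the stacked input `ū_t` has a row of `[D, CB, CAB, …]` as its target, whose `ℓ¹` norm is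
at most `2 c³ / (1 - ρ)` by stability (`LTI.LinSys.IsStable.sum_abs_markov_le`). If half the penalty
`λ` dominates the correlations of the residual with the columns of the design, the error `d` of a
row satisfies `‖d‖₁ ≤ 4 ‖g‖₁` and has small prediction error. If the Gram matrix of the design is
entrywise within `δ` of `σu²` times the identity, this gives
`σu² ‖d‖₂² ≤ 3 λ ‖g‖₁ + 16 δ ‖g‖₁²` (`lasso_slow_rate`). The two terms correspond to `err₁` and
`err₂`. No restricted eigenvalue condition is used.

The design has dependent rows, as its columns are shifts of the same inputs. The squared
norm of a column is a chi-square variable, and all other correlations are sums whose terms, in a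
suitable order, each contain a fresh independent variable multiplied by a coefficient that depends
on earlier variables only. For such sums `exp (∑ (θ f ξ - θ² σ² f² / 2))` has
expectation at most `1`, where the order is that of integrating out the coordinates of a product
measure (`lintegral_exp_sum_le_one`). This yields the self-normalized bound
`measure_abs_selfNormalized_le`, used for pairs of columns (the fresh variable is the more recent
input) and for the noise (the fresh variables are the noise entries, the coefficients depend on the
inputs). The full response to the process noise is kept, without truncation; its conditional
variance is bounded by Schur's test. The response to the inputs older than the memory `T` is bounded
by the Cauchy-Schwarz inequality and a weighted chi-square bound
(`measure_weighted_sum_sq_gaussian_le`), and is at most a multiple of `ε` because `T` exceeds a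
multiple of `T₀` (`memory_length_bounds`). The same lemma bounds the truncated Markov parameters by
`ε'`.

Finally, a row of the Hankel error is a shifted row of the Markov error, and the rows beyond `T`
decay geometrically (`errorBounds_of_rowErr`), which gives all four norms and all orders `K` at
once.
-/

/-! ### Exponential moments by integrating out coordinates -/

/-- A supermartingale bound without filtrations: on a product space, let each summand `Φ a` have
conditional exponential moment at most `1` in its own coordinate `idx a`, and let the other
summands of rank at most `r a` not depend on that coordinate. Then the exponential of the sum has
expectation at most `1`, by integrating out the coordinates in the order of decreasing rank. -/
theorem lintegral_exp_sum_le_one {ι κ : Type*} [Fintype ι] [DecidableEq ι]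
    (ν : ι → Measure ℝ) [∀ i, IsProbabilityMeasure (ν i)] (F : Finset κ) (idx : κ → ι)
    (r : κ → ℕ) (Φ : κ → (ι → ℝ) → ℝ) (hΦ : ∀ a ∈ F, Measurable (Φ a))
    (hstep : ∀ a ∈ F, ∀ x, ∫⁻ y, ENNReal.ofReal
      (Real.exp (Φ a (Function.update x (idx a) y))) ∂ν (idx a) ≤ 1)
    (hinv : ∀ a ∈ F, ∀ b ∈ F, a ≠ b → r b ≤ r a → ∀ x y,
      Φ b (Function.update x (idx a) y) = Φ b x) :
    ∫⁻ x, ENNReal.ofReal (Real.exp (∑ a ∈ F, Φ a x)) ∂Measure.pi ν ≤ 1 := by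
  classical
  induction F using Finset.induction_on_max_value r with
  | empty => simp
  | insert a s has hmax ih =>
    have hm : ∀ b ∈ s, Measurable (Φ b) := fun b hb => hΦ b (Finset.mem_insert_of_mem hb)
    have hrest : ∀ x y, ∑ b ∈ s, Φ b (Function.update x (idx a) y) = ∑ b ∈ s, Φ b x := by
      intro x y
      refine Finset.sum_congr rfl fun b hb => ?_
      exact hinv a (Finset.mem_insert_self a s) b (Finset.mem_insert_of_mem hb)
        (by rintro rfl; exact has hb) (hmax b hb) x y
    refine le_trans ?_ (ih hm (fun b hb => hstep b (Finset.mem_insert_of_mem hb))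
      (fun b hb b' hb' => hinv b (Finset.mem_insert_of_mem hb) b' (Finset.mem_insert_of_mem hb')))
    refine lintegral_le_of_lmarginal_le {idx a} ?_ ?_ ?_
    · exact (Finset.measurable_fun_sum _ hΦ).exp.ennreal_ofReal
    · exact (Finset.measurable_fun_sum _ hm).exp.ennreal_ofReal
    · rw [lmarginal_singleton, lmarginal_singleton]
      intro x
      simp only [Finset.sum_insert has, hrest, Real.exp_add, lintegral_const, measure_univ, mul_one,
        ENNReal.ofReal_mul (Real.exp_pos _).le]
      rw [lintegral_mul_const' _ _ ENNReal.ofReal_ne_top]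
      calc _ ≤ 1 * ENNReal.ofReal (Real.exp (∑ b ∈ s, Φ b x)) := by
            gcongr; exact hstep a (Finset.mem_insert_self a s) x
        _ = _ := one_mul _

/-- Chernoff's bound for `lintegral_exp_sum_le_one`, for independent random variables. -/
theorem measure_le_sum_le_exp_neg {Ω ι κ : Type*} [MeasurableSpace Ω] {μ : Measure Ω}
    [IsProbabilityMeasure μ] [Fintype ι] [DecidableEq ι]
    {ξ : ι → Ω → ℝ} (hξ : iIndepFun ξ μ) (hm : ∀ i, AEMeasurable (ξ i) μ)
    (F : Finset κ) (idx : κ → ι)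
    (r : κ → ℕ) (Φ : κ → (ι → ℝ) → ℝ) (hΦ : ∀ a ∈ F, Measurable (Φ a))
    (hstep : ∀ a ∈ F, ∀ x, ∫⁻ y, ENNReal.ofReal
      (Real.exp (Φ a (Function.update x (idx a) y))) ∂(μ.map (ξ (idx a))) ≤ 1)
    (hinv : ∀ a ∈ F, ∀ b ∈ F, a ≠ b → r b ≤ r a → ∀ x y,
      Φ b (Function.update x (idx a) y) = Φ b x) (l : ℝ) :
    μ {ω | l ≤ ∑ a ∈ F, Φ a (fun i => ξ i ω)} ≤ ENNReal.ofReal (Real.exp (-l)) := by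
  have hprob : ∀ i, IsProbabilityMeasure (μ.map (ξ i)) :=
    fun i => Measure.isProbabilityMeasure_map (hm i)
  have hmeas : Measurable fun x : ι → ℝ => ∑ a ∈ F, Φ a x := Finset.measurable_fun_sum _ hΦ
  have hset : MeasurableSet {x : ι → ℝ | l ≤ ∑ a ∈ F, Φ a x} :=
    measurableSet_le measurable_const hmeas
  have hmap := (iIndepFun_iff_map_fun_eq_pi_map hm).1 hξ
  have hae : AEMeasurable (fun ω i => ξ i ω) μ := aemeasurable_pi_iff.2 hm
  have h1 : μ {ω | l ≤ ∑ a ∈ F, Φ a (fun i => ξ i ω)}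
      = Measure.pi (fun i => μ.map (ξ i)) {x | l ≤ ∑ a ∈ F, Φ a x} := by
    rw [← hmap, Measure.map_apply_of_aemeasurable hae hset]; rfl
  rw [h1]
  have h2 := meas_ge_le_lintegral_div (μ := Measure.pi (fun i => μ.map (ξ i)))
    (f := fun x => ENNReal.ofReal (Real.exp (∑ a ∈ F, Φ a x)))
    hmeas.exp.ennreal_ofReal.aemeasurable
    (ε := ENNReal.ofReal (Real.exp l)) (by simp [Real.exp_pos]) ENNReal.ofReal_ne_top
  have h3 : {x : ι → ℝ | l ≤ ∑ a ∈ F, Φ a x} =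
      {x | ENNReal.ofReal (Real.exp l) ≤ ENNReal.ofReal (Real.exp (∑ a ∈ F, Φ a x))} := by
    ext x
    simp only [Set.mem_ofPred_eq]
    rw [ENNReal.ofReal_le_ofReal_iff (Real.exp_pos _).le, Real.exp_le_exp]
  rw [h3]
  refine h2.trans ?_
  rw [Real.exp_neg, ENNReal.ofReal_inv_of_pos (Real.exp_pos _), ← one_div]
  gcongr
  exact lintegral_exp_sum_le_one _ F idx r Φ hΦ hstep hinv

theorem ProbabilityTheory.HasSubgaussianMGF.lintegral_exp_le_one {Ω : Type*}
    [MeasurableSpace Ω] {μ : Measure Ω} {X : Ω → ℝ} {c : ℝ≥0} (hX : HasSubgaussianMGF X c μ)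
    (a : ℝ) :
    ∫⁻ y, ENNReal.ofReal (Real.exp (a * y - c * a ^ 2 / 2)) ∂(μ.map X) ≤ 1 := by
  rw [lintegral_map' (by fun_prop) hX.aemeasurable]
  simp only [Real.exp_sub]
  rw [← ofReal_integral_eq_lintegral_ofReal ((hX.integrable_exp_mul a).div_const _)
    (Filter.Eventually.of_forall fun _ => by positivity), integral_div]
  rw [ENNReal.ofReal_le_one]
  exact (div_le_one (Real.exp_pos _)).2 (hX.mgf_le a)

theorem ProbabilityTheory.HasLaw.hasSubgaussianMGF_gaussian {Ω : Type*}
    [MeasurableSpace Ω] {μ : Measure Ω} {X : Ω → ℝ} {v : ℝ≥0} (hX : HasLaw X (gaussianReal 0 v) μ) :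
    HasSubgaussianMGF X v μ where
  integrable_exp_mul t := by
    have := integrable_exp_mul_gaussianReal (μ := 0) (v := v) t
    rw [← hX.map_eq] at this
    exact (integrable_map_measure (by fun_prop) hX.aemeasurable).1 this
  mgf_le t := by
    rw [mgf_gaussianReal hX.map_eq]; simp

/-- Equivalent to `-log (1 - z) ≤ z + z²`. -/
theorem exp_neg_add_sq_le {z : ℝ} (hz : z ≤ 1 / 2) : Real.exp (-(z + z ^ 2)) ≤ 1 - z := by
  rcases le_total 0 z with h | h
  · have h1 := Real.quadratic_le_exp_of_nonneg (x := z + z ^ 2) (by positivity)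
    have h2 : 1 ≤ (1 - z) * Real.exp (z + z ^ 2) := by
      calc (1 : ℝ) ≤ (1 - z) * (1 + (z + z ^ 2) + (z + z ^ 2) ^ 2 / 2) := by
            have h3 : 0 ≤ 1 - z - z ^ 2 - z ^ 3 := by
              have := pow_le_pow_left₀ h hz 2
              have := pow_le_pow_left₀ h hz 3
              linarith
            nlinarith [mul_nonneg (sq_nonneg z) h3]
        _ ≤ _ := by gcongr; linarith
    rw [Real.exp_neg]
    exact (inv_le_iff_one_le_mul₀ (Real.exp_pos _)).2 h2
  · have h1 := Real.add_one_le_exp (z + z ^ 2)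
    have h2 : 0 < z + z ^ 2 + 1 := by nlinarith [sq_nonneg (z + 1)]
    rw [Real.exp_neg]
    calc _ ≤ (z + z ^ 2 + 1)⁻¹ := by gcongr
      _ ≤ 1 - z := by
        rw [inv_le_iff_one_le_mul₀ h2]
        nlinarith [mul_nonneg (sq_nonneg z) (neg_nonneg.2 h)]

/-- The centred square of a Gaussian variable of variance `v` has moment generating function at
most `exp (2 s² v²)` for `s v ≤ 1 / 4`, negative `s` included. -/
theorem lintegral_exp_sq_gaussian_le_one {v : ℝ≥0} (hv : v ≠ 0) {s : ℝ} (hs : s * v ≤ 1 / 4) :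
    ∫⁻ y, ENNReal.ofReal (Real.exp (s * (y ^ 2 - v) - 2 * s ^ 2 * v ^ 2)) ∂(gaussianReal 0 v)
      ≤ 1 := by
  have hv' : (0 : ℝ) < v := by positivity
  set b : ℝ := (1 - 2 * s * v) / (2 * v) with hb
  have hbpos : 0 < b := by apply div_pos <;> nlinarith
  set K : ℝ := Real.exp (-(s * v) - 2 * s ^ 2 * v ^ 2) * (√(2 * Real.pi * v))⁻¹ with hK
  rw [gaussianReal_of_var_ne_zero _ hv,
    lintegral_withDensity_eq_lintegral_mul _ (measurable_gaussianPDF _ _) (by fun_prop)]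
  have h1 : ∀ y, (gaussianPDF 0 v *
      fun y => ENNReal.ofReal (Real.exp (s * (y ^ 2 - v) - 2 * s ^ 2 * v ^ 2))) y
      = ENNReal.ofReal (K * Real.exp (-b * y ^ 2)) := by
    intro y
    simp only [Pi.mul_apply, gaussianPDF, gaussianPDFReal]
    rw [← ENNReal.ofReal_mul (by positivity)]
    congr 1
    have e : -(y - 0) ^ 2 / (2 * v) + (s * (y ^ 2 - v) - 2 * s ^ 2 * v ^ 2)
        = (-(s * v) - 2 * s ^ 2 * v ^ 2) + -b * y ^ 2 := by
      rw [hb]; field_simp; ring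
    rw [hK, mul_assoc, ← Real.exp_add, e, Real.exp_add]
    ring
  simp only [h1]
  rw [← ofReal_integral_eq_lintegral_ofReal ((integrable_exp_neg_mul_sq hbpos).const_mul _)
    (Filter.Eventually.of_forall fun _ => by positivity), integral_const_mul, integral_gaussian,
    ENNReal.ofReal_le_one]
  have h2 : (√(2 * Real.pi * v))⁻¹ * √(Real.pi / b) = √((1 - 2 * s * v)⁻¹) := by
    rw [← Real.sqrt_inv, ← Real.sqrt_mul (by positivity)]
    congr 1
    rw [hb]
    have : 1 - 2 * s * v ≠ 0 := by nlinarith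
    field_simp
  rw [hK, mul_assoc, h2]
  set z := 2 * s * v with hz
  have hz2 : z ≤ 1 / 2 := by rw [hz]; linarith
  have h3 : (1 - z)⁻¹ ≤ Real.exp (2 * (s * v + 2 * s ^ 2 * v ^ 2)) := by
    have e : 2 * (s * v + 2 * s ^ 2 * v ^ 2) = z + z ^ 2 := by rw [hz]; ring
    rw [e, inv_le_comm₀ (by linarith) (Real.exp_pos _), ← Real.exp_neg]
    exact exp_neg_add_sq_le hz2
  calc _ ≤ Real.exp (-(s * v) - 2 * s ^ 2 * v ^ 2) *
        √(Real.exp (2 * (s * v + 2 * s ^ 2 * v ^ 2))) := by gcongr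
    _ = 1 := by
      rw [← Real.exp_half, ← Real.exp_add, Real.exp_eq_one_iff]; ring

/-! ### Deviation bounds for independent variables -/

section Concentration

variable {Ω ι κ : Type*} [MeasurableSpace Ω] {μ : Measure Ω} [IsProbabilityMeasure μ] [Fintype ι]
  {ξ : ι → Ω → ℝ}

/-- A self-normalized deviation bound for a sum `∑ f a * ξ (idx a)` with predictable
coefficients: in the order given by the rank `r`, no coefficient depends on a variable that comes
at the same time or later. -/
theorem measure_selfNormalized_le (hξ : iIndepFun ξ μ) (hm : ∀ i, AEMeasurable (ξ i) μ)
    [Fintype κ] (idx : κ → ι) (hidx : Function.Injective idx) (r : κ → ℕ)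
    (c : κ → ℝ≥0) (hc : ∀ a, HasSubgaussianMGF (ξ (idx a)) (c a) μ)
    (f : κ → (ι → ℝ) → ℝ) (hf : ∀ a, Measurable (f a))
    (hinv : ∀ a b, r b ≤ r a → ∀ x y, (∀ i ≠ idx a, x i = y i) → f b x = f b y) (l : ℝ) :
    μ {ω | l ≤ ∑ a, (f a (fun i => ξ i ω) * ξ (idx a) ω - c a * f a (fun i => ξ i ω) ^ 2 / 2)}
      ≤ ENNReal.ofReal (Real.exp (-l)) := by
  classical
  have hupd : ∀ a b, r b ≤ r a → ∀ x y, f b (Function.update x (idx a) y) = f b x :=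
    fun a b hab x y => hinv a b hab _ _ fun i hi => Function.update_of_ne hi _ _
  refine measure_le_sum_le_exp_neg hξ hm Finset.univ idx r
    (fun a x => f a x * x (idx a) - c a * f a x ^ 2 / 2) ?_ ?_ ?_ l
  · intro a _; have := hf a; fun_prop
  · intro a _ x
    simp only [hupd a a le_rfl, Function.update_self]
    exact (hc a).lintegral_exp_le_one _
  · intro a _ b _ hab hr x y
    simp only [hupd a b hr]
    rw [Function.update_of_ne (fun h => hab (hidx h).symm)]

theorem measure_abs_selfNormalized_le (hξ : iIndepFun ξ μ) (hm : ∀ i, AEMeasurable (ξ i) μ)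
    [Fintype κ] (idx : κ → ι) (hidx : Function.Injective idx) (r : κ → ℕ)
    (c : κ → ℝ≥0) (hc : ∀ a, HasSubgaussianMGF (ξ (idx a)) (c a) μ)
    (f : κ → (ι → ℝ) → ℝ) (hf : ∀ a, Measurable (f a))
    (hinv : ∀ a b, r b ≤ r a → ∀ x y, (∀ i ≠ idx a, x i = y i) → f b x = f b y) (l : ℝ)
    {θ : ℝ} (hθ : 0 < θ) :
    μ {ω | l / θ + θ / 2 * ∑ a, c a * f a (fun i => ξ i ω) ^ 2
        ≤ |∑ a, f a (fun i => ξ i ω) * ξ (idx a) ω|}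
      ≤ 2 * ENNReal.ofReal (Real.exp (-l)) := by
  have key : ∀ s : ℝ, s ^ 2 = θ ^ 2 →
      μ {ω | l ≤ s * ∑ a, f a (fun i => ξ i ω) * ξ (idx a) ω
        - θ ^ 2 / 2 * ∑ a, c a * f a (fun i => ξ i ω) ^ 2} ≤ ENNReal.ofReal (Real.exp (-l)) := by
    intro s hs
    convert measure_selfNormalized_le hξ hm idx hidx r c hc (fun a x => s * f a x)
      (fun a => (hf a).const_mul s) (fun a b hab x y h => by simp only [hinv a b hab x y h]) l
      using 5 with ω
    rw [Finset.mul_sum, Finset.mul_sum, ← Finset.sum_sub_distrib, ← hs]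
    refine Finset.sum_congr rfl fun a _ => by ring
  rw [two_mul]
  refine le_trans (measure_mono ?_) ((measure_union_le _ _).trans
    (add_le_add (key θ rfl) (key (-θ) (by ring))))
  intro ω hω
  simp only [Set.mem_ofPred_eq, Set.mem_union] at hω ⊢
  have h1 : l + θ ^ 2 / 2 * ∑ a, c a * f a (fun i => ξ i ω) ^ 2
      ≤ θ * |∑ a, f a (fun i => ξ i ω) * ξ (idx a) ω| := by
    refine le_trans (le_of_eq ?_) (mul_le_mul_of_nonneg_left hω hθ.le)
    field_simp
  rcases abs_cases (∑ a, f a (fun i => ξ i ω) * ξ (idx a) ω) with h | h <;> rw [h.1] at h1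
  · left; linarith
  · right; linarith

theorem measure_sum_sq_gaussian_le (hξ : iIndepFun ξ μ) (hm : ∀ i, AEMeasurable (ξ i) μ)
    [Fintype κ] (idx : κ → ι) (hidx : Function.Injective idx) {σ : ℝ≥0} (hσ : 0 < σ)
    (hg : ∀ a, HasLaw (ξ (idx a)) (gaussianReal 0 (σ ^ 2)) μ) (b : κ → ℝ)
    (hb : ∀ a, b a * σ ^ 2 ≤ 1 / 4) (l : ℝ) :
    μ {ω | l ≤ ∑ a, (b a * (ξ (idx a) ω ^ 2 - σ ^ 2) - 2 * b a ^ 2 * (σ ^ 2) ^ 2)}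
      ≤ ENNReal.ofReal (Real.exp (-l)) := by
  classical
  refine measure_le_sum_le_exp_neg hξ hm Finset.univ idx (fun _ => 0)
    (fun a x => b a * (x (idx a) ^ 2 - σ ^ 2) - 2 * b a ^ 2 * (σ ^ 2) ^ 2) ?_ ?_ ?_ l
  · intro a _; fun_prop
  · intro a _ x
    rw [(hg a).map_eq]
    have := lintegral_exp_sq_gaussian_le_one (v := σ ^ 2) (by positivity) (s := b a)
      (by simpa using hb a)
    simpa using this
  · intro a _ c _ hac _ x y
    rw [Function.update_of_ne (fun h => hac (hidx h).symm)]

/-- A weighted chi-square variable with weights at most `H` and of total weight at most `M * H`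
exceeds three times the bound `σ² M H` on its mean with probability exponentially small in `M`. -/
theorem measure_weighted_sum_sq_gaussian_le (hξ : iIndepFun ξ μ)
    (hm : ∀ i, AEMeasurable (ξ i) μ)
    [Fintype κ] (idx : κ → ι) (hidx : Function.Injective idx) {σ : ℝ≥0} (hσ : 0 < σ)
    (hg : ∀ a, HasLaw (ξ (idx a)) (gaussianReal 0 (σ ^ 2)) μ) (b : κ → ℝ) {H M : ℝ} (hH : 0 < H)
    (hb0 : ∀ a, 0 ≤ b a) (hb : ∀ a, b a ≤ H) (hbs : ∑ a, b a ≤ M * H) :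
    μ {ω | 3 * σ ^ 2 * M * H ≤ ∑ a, b a * ξ (idx a) ω ^ 2}
      ≤ ENNReal.ofReal (Real.exp (-(3 * M / 8))) := by
  have hσ' : (0 : ℝ) < σ := by exact_mod_cast hσ
  -- the largest exponent allowed in `lintegral_exp_sq_gaussian_le_one` for weights up to `H`
  set s : ℝ := 1 / (4 * H * σ ^ 2) with hs
  have hs0 : 0 < s := by positivity
  refine le_trans (measure_mono ?_) (measure_sum_sq_gaussian_le hξ hm idx hidx hσ hg
    (fun a => s * b a) (fun a => ?_) (3 * M / 8))
  · intro ω hω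
    simp only [Set.mem_ofPred_eq] at hω ⊢
    have h1 : ∑ a, (s * b a * (ξ (idx a) ω ^ 2 - σ ^ 2) - 2 * (s * b a) ^ 2 * (σ ^ 2) ^ 2)
        = s * ∑ a, b a * ξ (idx a) ω ^ 2 - s * σ ^ 2 * ∑ a, b a
          - 2 * s ^ 2 * σ ^ 4 * ∑ a, b a ^ 2 := by
      simp only [Finset.mul_sum, ← Finset.sum_sub_distrib]
      exact Finset.sum_congr rfl fun a _ => by ring
    have h2 : ∑ a, b a ^ 2 ≤ H * (M * H) := by
      calc ∑ a, b a ^ 2 ≤ ∑ a, H * b a := Finset.sum_le_sum fun a _ => by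
            rw [sq]; exact mul_le_mul_of_nonneg_right (hb a) (hb0 a)
        _ ≤ _ := by rw [← Finset.mul_sum]; gcongr
    rw [h1]
    have e1 : s * (3 * σ ^ 2 * M * H) = 3 * M / 4 := by rw [hs]; field_simp
    have e2 : s * σ ^ 2 * (M * H) = M / 4 := by rw [hs]; field_simp
    have e3 : 2 * s ^ 2 * σ ^ 4 * (H * (M * H)) = M / 8 := by rw [hs]; field_simp; ring
    have f1 := mul_le_mul_of_nonneg_left hω hs0.le
    have f2 := mul_le_mul_of_nonneg_left hbs (by positivity : 0 ≤ s * (σ : ℝ) ^ 2)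
    have f3 := mul_le_mul_of_nonneg_left h2 (by positivity : 0 ≤ 2 * s ^ 2 * (σ : ℝ) ^ 4)
    linarith
  · have : s * H * σ ^ 2 = 1 / 4 := by rw [hs]; field_simp
    rw [← this]
    have := hb a
    gcongr

theorem measure_abs_sum_sq_gaussian_le (hξ : iIndepFun ξ μ)
    (hm : ∀ i, AEMeasurable (ξ i) μ) [Fintype κ] (idx : κ → ι)
    (hidx : Function.Injective idx) {σ : ℝ≥0} (hσ : 0 < σ)
    (hg : ∀ a, HasLaw (ξ (idx a)) (gaussianReal 0 (σ ^ 2)) μ) {l q : ℝ} (hq0 : 0 ≤ q)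
    (hq1 : q ≤ 1) (hq : 8 * l ≤ Fintype.card κ * q ^ 2) :
    μ {ω | Fintype.card κ * σ ^ 2 * q ≤ |∑ a, ξ (idx a) ω ^ 2 - Fintype.card κ * σ ^ 2|}
      ≤ 2 * ENNReal.ofReal (Real.exp (-l)) := by
  have hσ' : (0 : ℝ) < σ := by exact_mod_cast hσ
  obtain ⟨M, hM⟩ : ∃ M : ℝ, M = Fintype.card κ := ⟨_, rfl⟩
  rw [← hM] at hq ⊢
  have key : ∀ s : ℝ, s ^ 2 = q ^ 2 → s ≤ 1 →
      μ {ω | l ≤ s / (4 * σ ^ 2) * (∑ a, ξ (idx a) ω ^ 2 - M * σ ^ 2) - M * q ^ 2 / 8}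
        ≤ ENNReal.ofReal (Real.exp (-l)) := by
    intro s hs hs1
    convert measure_sum_sq_gaussian_le hξ hm idx hidx hσ hg (fun a => s / (4 * σ ^ 2))
      (fun a => ?_) l using 5 with ω
    · rw [Finset.sum_sub_distrib, ← Finset.mul_sum, Finset.sum_sub_distrib]
      simp only [Finset.sum_const, Finset.card_univ, nsmul_eq_mul]
      rw [← hs, ← hM]
      field_simp
      ring
    · have : s / (4 * (σ : ℝ) ^ 2) * σ ^ 2 = s / 4 := by field_simp
      rw [this]; linarith
  rw [two_mul]
  refine le_trans (measure_mono ?_) ((measure_union_le _ _).trans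
    (add_le_add (key q rfl hq1) (key (-q) (by ring) (by linarith))))
  intro ω hω
  simp only [Set.mem_ofPred_eq, Set.mem_union] at hω ⊢
  have h1 := mul_le_mul_of_nonneg_left hω (by positivity : 0 ≤ q / (4 * (σ : ℝ) ^ 2))
  have e1 : q / (4 * (σ : ℝ) ^ 2) * (M * σ ^ 2 * q) = M * q ^ 2 / 4 := by field_simp
  rcases abs_cases (∑ a, ξ (idx a) ω ^ 2 - M * σ ^ 2) with h | h <;> rw [h.1] at h1
  · left; linarith
  · right
    rw [neg_div, neg_mul]; linarith

end Concentration

/-! ### The lasso without sparsity -/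

section Lasso

variable {R Q : Type*} [Fintype R] [Fintype Q]

/-- The optimality of `x` against `g`, when the penalty dominates the correlation between noise
and design. -/
theorem lasso_basic_inequality (φ : R → Q → ℝ) (y : R → ℝ) (g x : Q → ℝ) {M lam : ℝ} (hM : 0 < M)
    (hlam : 0 < lam)
    (hopt : 1 / (2 * M) * ∑ r, (y r - ∑ q, x q * φ r q) ^ 2 + lam * ∑ q, |x q|
      ≤ 1 / (2 * M) * ∑ r, (y r - ∑ q, g q * φ r q) ^ 2 + lam * ∑ q, |g q|)
    (hnoise : ∀ q, |∑ r, (y r - ∑ q, g q * φ r q) * φ r q| ≤ M * (lam / 2)) :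
    ∑ q, |x q - g q| ≤ 4 * ∑ q, |g q| ∧
      ∑ r, (∑ q, (x q - g q) * φ r q) ^ 2 ≤ 3 * M * lam * ∑ q, |g q| := by
  set e : R → ℝ := fun r => y r - ∑ q, g q * φ r q with he
  set d : R → ℝ := fun r => ∑ q, (x q - g q) * φ r q with hd
  have h1 : ∀ r, y r - ∑ q, x q * φ r q = e r - d r := by
    intro r
    simp only [he, hd, sub_mul, Finset.sum_sub_distrib]; ring
  have h2 : ∑ r, (y r - ∑ q, x q * φ r q) ^ 2
      = ∑ r, e r ^ 2 - 2 * ∑ r, e r * d r + ∑ r, d r ^ 2 := by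
    rw [Finset.mul_sum, ← Finset.sum_sub_distrib, ← Finset.sum_add_distrib]
    exact Finset.sum_congr rfl fun r _ => by rw [h1]; ring
  have h3 : ∑ r, e r * d r = ∑ q, (x q - g q) * ∑ r, e r * φ r q := by
    simp only [hd, Finset.mul_sum]
    rw [Finset.sum_comm]
    exact Finset.sum_congr rfl fun q _ => Finset.sum_congr rfl fun r _ => by ring
  have h4 : ∑ r, e r * d r ≤ M * (lam / 2) * ∑ q, |x q - g q| := by
    rw [h3, Finset.mul_sum]
    refine Finset.sum_le_sum fun q _ => (le_abs_self _).trans ?_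
    rw [abs_mul, mul_comm]
    exact mul_le_mul_of_nonneg_right (hnoise q) (abs_nonneg _)
  have h5 : ∑ q, |x q - g q| ≤ ∑ q, |x q| + ∑ q, |g q| := by
    rw [← Finset.sum_add_distrib]
    exact Finset.sum_le_sum fun q _ => abs_sub _ _
  rw [h2] at hopt
  have h6 : ∑ r, d r ^ 2 ≤ 2 * ∑ r, e r * d r + 2 * M * lam * (∑ q, |g q| - ∑ q, |x q|) := by
    have := mul_le_mul_of_nonneg_left hopt (by positivity : 0 ≤ 2 * M)
    have e1 : ∀ z w : ℝ, 2 * M * (1 / (2 * M) * z + lam * w) = z + 2 * M * lam * w := by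
      intro z w; field_simp
    rw [e1, e1] at this
    linarith
  have h7 : 0 ≤ ∑ r, d r ^ 2 := Finset.sum_nonneg fun _ _ => sq_nonneg _
  have hMl : 0 < M * lam := by positivity
  have h8 := mul_le_mul_of_nonneg_left h5 hMl.le
  have hx : 0 ≤ ∑ q, |x q| := Finset.sum_nonneg fun _ _ => abs_nonneg _
  constructor
  · have : M * lam * ∑ q, |x q| ≤ M * lam * (3 * ∑ q, |g q|) := by linarith
    have := le_of_mul_le_mul_left this hMl
    linarith
  · have := mul_nonneg hMl.le hx
    linarith

/-- Entrywise closeness of the Gram matrix to `V` times the identity gives restricted strong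
convexity, with an error that is quadratic in the `ℓ¹` norm. -/
theorem sum_sq_le_of_gram [DecidableEq Q] (φ : R → Q → ℝ) (d : Q → ℝ) {V δ : ℝ}
    (hG : ∀ a b, |∑ r, φ r a * φ r b - (if a = b then V else 0)| ≤ δ) :
    V * ∑ q, d q ^ 2 ≤ ∑ r, (∑ q, d q * φ r q) ^ 2 + δ * (∑ q, |d q|) ^ 2 := by
  have h1 : ∑ r, (∑ q, d q * φ r q) ^ 2 = ∑ a, ∑ b, d a * d b * ∑ r, φ r a * φ r b := by
    have : ∀ r, (∑ q, d q * φ r q) ^ 2 = ∑ a, ∑ b, d a * d b * (φ r a * φ r b) := by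
      intro r
      rw [sq, Finset.sum_mul_sum]
      exact Finset.sum_congr rfl fun a _ => Finset.sum_congr rfl fun b _ => by ring
    simp only [this, Finset.mul_sum]
    rw [Finset.sum_comm]
    exact Finset.sum_congr rfl fun a _ => Finset.sum_comm
  have h2 : V * ∑ q, d q ^ 2 = ∑ a, ∑ b, d a * d b * (if a = b then V else 0) := by
    simp only [mul_ite, mul_zero, Finset.sum_ite_eq, Finset.mem_univ, if_true, Finset.mul_sum]
    exact Finset.sum_congr rfl fun a _ => by ring
  have h3 : δ * (∑ q, |d q|) ^ 2 = ∑ a, ∑ b, |d a| * |d b| * δ := by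
    rw [sq, Finset.sum_mul_sum, Finset.mul_sum]
    refine Finset.sum_congr rfl fun a _ => ?_
    rw [Finset.mul_sum]
    exact Finset.sum_congr rfl fun b _ => by ring
  rw [h1, h2, h3, ← Finset.sum_add_distrib]
  refine Finset.sum_le_sum fun a _ => ?_
  rw [← Finset.sum_add_distrib]
  refine Finset.sum_le_sum fun b _ => ?_
  have h4 := mul_le_mul_of_nonneg_left (hG a b) (mul_nonneg (abs_nonneg (d a)) (abs_nonneg (d b)))
  rw [← abs_mul, ← abs_mul] at h4
  have h5 := neg_abs_le (d a * d b * (∑ r, φ r a * φ r b - if a = b then V else 0))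
  rw [← abs_mul]
  linarith [h5, h4, mul_sub (d a * d b) (∑ r, φ r a * φ r b) (if a = b then V else 0)]

/-- The `ℓ²` error of the lasso in terms of the `ℓ¹` norm of the target only; no sparsity is
involved. -/
theorem lasso_slow_rate [DecidableEq Q] (φ : R → Q → ℝ) (y : R → ℝ) (g x : Q → ℝ)
    {M lam V δ G : ℝ} (hM : 0 < M) (hlam : 0 < lam) (hδ : 0 ≤ δ)
    (hopt : 1 / (2 * M) * ∑ r, (y r - ∑ q, x q * φ r q) ^ 2 + lam * ∑ q, |x q|
      ≤ 1 / (2 * M) * ∑ r, (y r - ∑ q, g q * φ r q) ^ 2 + lam * ∑ q, |g q|)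
    (hnoise : ∀ q, |∑ r, (y r - ∑ q, g q * φ r q) * φ r q| ≤ M * (lam / 2))
    (hG : ∀ a b, |∑ r, φ r a * φ r b - (if a = b then M * V else 0)| ≤ M * δ)
    (hg : ∑ q, |g q| ≤ G) :
    V * ∑ q, (x q - g q) ^ 2 ≤ 3 * lam * G + 16 * δ * G ^ 2 := by
  obtain ⟨h1, h2⟩ := lasso_basic_inequality φ y g x hM hlam hopt hnoise
  have h3 := sum_sq_le_of_gram φ (fun q => x q - g q) hG
  have h4 : (∑ q, |x q - g q|) ^ 2 ≤ (4 * G) ^ 2 :=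
    pow_le_pow_left₀ (Finset.sum_nonneg fun _ _ => abs_nonneg _) (by linarith) 2
  have h5 := mul_le_mul_of_nonneg_left h4 (by positivity : 0 ≤ M * δ)
  have h6 := mul_le_mul_of_nonneg_left hg (by positivity : 0 ≤ 3 * M * lam)
  have h7 : M * (V * ∑ q, (x q - g q) ^ 2) ≤ M * (3 * lam * G + 16 * δ * G ^ 2) := by
    linarith
  exact le_of_mul_le_mul_left h7 hM

end Lasso

theorem sum_Icc_window {T N : ℕ} (hT : 0 < T) (hN : 0 < N) (f : ℕ → ℝ) :
    ∑ t ∈ Finset.Icc (T - 1) (N + T - 2), f t = ∑ r : Fin N, f (T - 1 + r) := by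
  rw [Fin.sum_univ_eq_sum_range (fun r => f (T - 1 + r))]
  have h : Finset.Icc (T - 1) (N + T - 2) = Finset.Ico (T - 1) (T - 1 + N) := by
    ext t; simp only [Finset.mem_Icc, Finset.mem_Ico]; omega
  rw [h, Finset.sum_Ico_eq_sum_range]
  simp

theorem lassoObjective_eq_sum {m p T N : ℕ} (hT : 0 < T) (hN : 0 < N) (lam : ℝ)
    (u : ℕ → Fin p → ℝ) (y : ℕ → Fin m → ℝ) (X : Matrix (Fin m) (Fin T × Fin p) ℝ) :
    lassoObjective T N lam u y X =
      ∑ i, (1 / (2 * (N : ℝ)) * ∑ r : Fin N, (y (T - 1 + r) i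
        - ∑ q, X i q * stackedInput T u (T - 1 + r) q) ^ 2 + lam * ∑ q, |X i q|) := by
  rw [lassoObjective, sum_Icc_window hT hN, Finset.sum_comm, Finset.sum_add_distrib,
    Finset.mul_sum, Finset.mul_sum]
  rfl

/-- The objective is a sum over the rows of the estimate, so each row is itself a lasso
estimate. -/
theorem LTI.IsLassoEstimate.row {m p T N : ℕ} (hT : 0 < T) (hN : 0 < N) {lam : ℝ}
    {u : ℕ → Fin p → ℝ} {y : ℕ → Fin m → ℝ} {X : Matrix (Fin m) (Fin T × Fin p) ℝ}
    (hX : IsLassoEstimate T N lam u y X) (i : Fin m) (g : Fin T × Fin p → ℝ) :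
    1 / (2 * (N : ℝ)) * ∑ r : Fin N, (y (T - 1 + r) i
        - ∑ q, X i q * stackedInput T u (T - 1 + r) q) ^ 2 + lam * ∑ q, |X i q| ≤
    1 / (2 * (N : ℝ)) * ∑ r : Fin N, (y (T - 1 + r) i
        - ∑ q, g q * stackedInput T u (T - 1 + r) q) ^ 2 + lam * ∑ q, |g q| := by
  have h := hX (Matrix.updateRow X i g)
  rw [lassoObjective_eq_sum hT hN, lassoObjective_eq_sum hT hN,
    ← Finset.add_sum_erase _ _ (Finset.mem_univ i),
    ← Finset.add_sum_erase _ _ (Finset.mem_univ i), Matrix.updateRow_self] at h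
  rw [Finset.sum_congr rfl (g := fun i => (1 / (2 * (N : ℝ)) * ∑ r : Fin N, (y (T - 1 + r) i
        - ∑ q, X i q * stackedInput T u (T - 1 + r) q) ^ 2 + lam * ∑ q, |X i q|))
      (s₁ := Finset.univ.erase i)
      (f := fun i' => (1 / (2 * (N : ℝ)) * ∑ r : Fin N, (y (T - 1 + r) i'
        - ∑ q, X.updateRow i g i' q * stackedInput T u (T - 1 + r) q) ^ 2
          + lam * ∑ q, |X.updateRow i g i' q|)) ?_] at h
  · linarith
  · intro j hj
    rw [Matrix.updateRow_ne (Finset.ne_of_mem_erase hj)]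

/-! ### From row errors to the four norms -/

theorem sq_rpow_half (a : ℝ≥0∞) : (a ^ (1 / 2 : ℝ)) ^ 2 = a := by
  rw [← ENNReal.rpow_natCast, ← ENNReal.rpow_mul]; norm_num

theorem rpow_half_le_ofReal {a : ℝ≥0∞} {b : ℝ} (hb : 0 ≤ b) (h : a ≤ ENNReal.ofReal (b ^ 2)) :
    a ^ (1 / 2 : ℝ) ≤ ENNReal.ofReal b := by
  have h1 := ENNReal.rpow_le_rpow h (by norm_num : (0 : ℝ) ≤ 1 / 2)
  rwa [ENNReal.ofReal_rpow_of_nonneg (by positivity) (by norm_num), ← Real.sqrt_eq_rpow,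
    Real.sqrt_sq hb] at h1

theorem l2Norm_sq {ι : Type*} (x : ι → ℝ) : l2Norm x ^ 2 = ∑' j, ‖x j‖ₑ ^ 2 := sq_rpow_half _

theorem l2Norm_le {ι : Type*} {x : ι → ℝ} {b : ℝ} (hb : 0 ≤ b)
    (h : ∑' j, ‖x j‖ₑ ^ 2 ≤ ENNReal.ofReal (b ^ 2)) : l2Norm x ≤ ENNReal.ofReal b :=
  rpow_half_le_ofReal hb h

theorem tsum_blockIdx_le {β : Type*} [Fintype β] (K : ℕ∞) (f : ℕ → β → ℝ≥0∞) :
    ∑' kj : BlockIdx K × β, f kj.1 kj.2 ≤ ∑' k, ∑ j, f k j := by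
  have h1 := ENNReal.tsum_comp_le_tsum_of_injective
    (f := fun kj : BlockIdx K × β => ((kj.1 : ℕ), kj.2))
    (fun a b h => by
      simp only [Prod.mk.injEq] at h
      exact Prod.ext (Subtype.ext h.1) h.2) (fun kj : ℕ × β => f kj.1 kj.2)
  refine h1.trans (le_of_eq ?_)
  rw [ENNReal.tsum_prod]
  exact tsum_congr fun k => tsum_fintype _

theorem tsum_ofReal_geometric {c ρ : ℝ} (hc : 0 ≤ c) (h0 : 0 ≤ ρ) (h1 : ρ < 1) :
    ∑' k, ENNReal.ofReal (c * ρ ^ k) = ENNReal.ofReal (c / (1 - ρ)) := by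
  rw [← ENNReal.ofReal_tsum_of_nonneg (fun _ => by positivity)
    ((summable_geometric_of_lt_one h0 h1).mul_left c), tsum_mul_left,
    tsum_geometric_of_lt_one h0 h1, div_eq_mul_inv]

section

variable {n p m T : ℕ} (sys : LinSys n p m) (X : Matrix (Fin m) (Fin T × Fin p) ℝ)

/-- The squared `ℓ²` error of the estimate in row `i` of the `k`-th block. -/
noncomputable def rowErr (i : Fin m) (k : ℕ) : ℝ≥0∞ :=
  ∑ j, ‖(sys.markov k - estimatedMarkov X k) i j‖ₑ ^ 2

variable {sys X}

theorem tsum_rowErr_tail_le {i : Fin m} {γ ρ : ℝ} (h0 : 0 ≤ ρ) (h1 : ρ < 1)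
    (htail : ∀ k, rowErr sys X i (T + k) ≤ ENNReal.ofReal (γ ^ 2 * ρ ^ k)) (r : ℕ) :
    ∑' k, rowErr sys X i (T + r + k) ≤ ENNReal.ofReal (γ ^ 2 / (1 - ρ) * ρ ^ r) := by
  calc ∑' k, rowErr sys X i (T + r + k)
      ≤ ∑' k, ENNReal.ofReal (γ ^ 2 * ρ ^ r * ρ ^ k) := by
        refine ENNReal.tsum_le_tsum fun k => ?_
        rw [add_assoc, mul_assoc, ← pow_add]
        exact htail _
    _ = _ := by
        rw [tsum_ofReal_geometric (by positivity) h0 h1]; congr 1; ring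

theorem tsum_rowErr_le {i : Fin m} {a γ ρ : ℝ} (h0 : 0 ≤ ρ) (h1 : ρ < 1)
    (hhead : ∑ k ∈ Finset.range T, rowErr sys X i k ≤ ENNReal.ofReal (a ^ 2))
    (htail : ∀ k, rowErr sys X i (T + k) ≤ ENNReal.ofReal (γ ^ 2 * ρ ^ k)) :
    ∑' k, rowErr sys X i k ≤ ENNReal.ofReal (a ^ 2 + (γ / (1 - ρ)) ^ 2) := by
  rw [← ENNReal.summable.sum_add_tsum_nat_add' (k := T),
    ENNReal.ofReal_add (by positivity) (by positivity)]
  refine add_le_add hhead ?_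
  have := tsum_rowErr_tail_le h0 h1 htail 0
  simp only [add_zero, pow_zero, mul_one] at this
  simp only [add_comm _ T]
  refine this.trans (ENNReal.ofReal_le_ofReal ?_)
  rw [div_pow]
  have : (1 - ρ) ^ 2 ≤ 1 - ρ := by nlinarith
  have : 0 < (1 - ρ) ^ 2 := by have : 0 < 1 - ρ := by linarith
                               positivity
  gcongr

/-- All four error bounds follow from the `ℓ²` errors of the rows of the estimated block and the
geometric decay of the truncated blocks, since a row of the Hankel error is a shifted row of the
Markov error. -/
theorem errorBounds_of_rowErr (hT : 0 < T) {a γ ρ b : ℝ} (h0 : 0 ≤ ρ) (h1 : ρ < 1) (hb : 0 ≤ b)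
    (hhead : ∀ i, ∑ k ∈ Finset.range T, rowErr sys X i k ≤ ENNReal.ofReal (a ^ 2))
    (htail : ∀ i k, rowErr sys X i (T + k) ≤ ENNReal.ofReal (γ ^ 2 * ρ ^ k))
    (hab : a ^ 2 + 2 * (γ / (1 - ρ)) ^ 2 ≤ b ^ 2) (K : ℕ∞) : ErrorBounds sys X K b := by
  set γ' := γ / (1 - ρ) with hγ'
  have hrow : ∀ i, ∑' k, rowErr sys X i k ≤ ENNReal.ofReal (a ^ 2 + γ' ^ 2) :=
    fun i => tsum_rowErr_le h0 h1 (hhead i) (htail i)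
  have hb1 : ENNReal.ofReal (a ^ 2 + γ' ^ 2) ≤ ENNReal.ofReal (b ^ 2) :=
    ENNReal.ofReal_le_ofReal (by nlinarith [sq_nonneg γ'])
  have hG : ∀ i, ∑' j, ‖(blockRow K sys.markov - blockRow K (estimatedMarkov X)) i j‖ₑ ^ 2
      ≤ ∑' k, rowErr sys X i k := fun i =>
    tsum_blockIdx_le K fun k j => ‖(sys.markov k - estimatedMarkov X k) i j‖ₑ ^ 2
  have hH : ∀ r : BlockIdx K × Fin m,
      ∑' j, ‖(blockHankel K sys.markov - blockHankel K (estimatedMarkov X)) r j‖ₑ ^ 2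
      ≤ ∑' k, rowErr sys X r.2 (r.1 + k) := fun r =>
    tsum_blockIdx_le K fun k j =>
      ‖(sys.markov (r.1 + k) - estimatedMarkov X (r.1 + k)) r.2 j‖ₑ ^ 2
  have hshift : ∀ i r, ∑' k, rowErr sys X i (r + k) ≤ ∑' k, rowErr sys X i k := fun i r =>
    ENNReal.tsum_comp_le_tsum_of_injective (add_right_injective r) (rowErr sys X i)
  refine ⟨?_, ?_, ?_, ?_⟩
  · exact iSup_le fun i => l2Norm_le hb ((hG i).trans ((hrow i).trans hb1))
  · refine rpow_half_le_ofReal (by positivity) ?_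
    simp only [l2Norm_sq]
    calc _ ≤ ∑' i : Fin m, ENNReal.ofReal (b ^ 2) :=
          ENNReal.tsum_le_tsum fun i => (hG i).trans ((hrow i).trans hb1)
      _ = ENNReal.ofReal ((√m * b) ^ 2) := by
          rw [tsum_fintype, Finset.sum_const, Finset.card_univ, Fintype.card_fin, mul_pow,
            Real.sq_sqrt (by positivity), ENNReal.ofReal_mul (by positivity),
            ENNReal.ofReal_natCast, nsmul_eq_mul]
  · exact iSup_le fun r => l2Norm_le hb
      ((hH r).trans ((hshift _ _).trans ((hrow r.2).trans hb1)))
  · refine rpow_half_le_ofReal (by positivity) ?_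
    simp only [l2Norm_sq]
    have h1' : 0 < 1 - ρ := by linarith
    calc _ ≤ ∑' r : BlockIdx K × Fin m, ∑' k, rowErr sys X r.2 (r.1 + k) :=
          ENNReal.tsum_le_tsum hH
      _ ≤ ∑' r : ℕ, ∑ i : Fin m, ∑' k, rowErr sys X i (r + k) :=
          tsum_blockIdx_le K fun r i => ∑' k, rowErr sys X i (r + k)
      _ = ∑ r ∈ Finset.range T, ∑ i : Fin m, ∑' k, rowErr sys X i (r + k)
          + ∑' r : ℕ, ∑ i : Fin m, ∑' k, rowErr sys X i (T + r + k) := by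
          rw [← ENNReal.summable.sum_add_tsum_nat_add' (k := T)]
          simp only [add_comm _ T]
      _ ≤ ∑ r ∈ Finset.range T, ∑ i : Fin m, ENNReal.ofReal (a ^ 2 + γ' ^ 2)
          + ∑' r : ℕ, ∑ i : Fin m, ENNReal.ofReal (γ ^ 2 / (1 - ρ) * ρ ^ r) := by
          gcongr with r _ i _ r i _
          · exact (hshift _ _).trans (hrow i)
          · exact tsum_rowErr_tail_le h0 h1 (htail i) r
      _ = ENNReal.ofReal (T * (m * (a ^ 2 + γ' ^ 2)) + m * γ' ^ 2) := by
          simp only [Finset.sum_const, Finset.card_univ, Fintype.card_fin, Finset.card_range,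
            nsmul_eq_mul]
          rw [ENNReal.tsum_mul_left, tsum_ofReal_geometric (by positivity) h0 h1,
            ENNReal.ofReal_add (p := T * (m * (a ^ 2 + γ' ^ 2))) (by positivity) (by positivity),
            ENNReal.ofReal_mul (p := T) (by positivity),
            ENNReal.ofReal_mul (p := m) (by positivity),
            ENNReal.ofReal_mul (p := m) (by positivity), ENNReal.ofReal_natCast,
            ENNReal.ofReal_natCast]
          congr 3
          rw [hγ']; field_simp
      _ ≤ ENNReal.ofReal ((√(T * m) * b) ^ 2) := by
          refine ENNReal.ofReal_le_ofReal ?_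
          rw [mul_pow, Real.sq_sqrt (by positivity)]
          have hT1 : (1 : ℝ) ≤ T := by exact_mod_cast hT
          have e1 := mul_le_mul_of_nonneg_left hab (by positivity : (0 : ℝ) ≤ T * m)
          have e2 := mul_le_mul_of_nonneg_right hT1 (by positivity : 0 ≤ m * γ' ^ 2)
          linarith

end

/-! ### Stable systems and their impulse responses -/

section MaxRowSum

variable {r s k : ℕ}

theorem sum_abs_row_le_maxRowSum (M : Matrix (Fin r) (Fin s) ℝ) (i : Fin r) :
    ∑ j, |M i j| ≤ maxRowSum M :=
  le_ciSup (f := fun i => ∑ j, |M i j|) (Set.finite_range _).bddAbove i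

theorem maxRowSum_nonneg (M : Matrix (Fin r) (Fin s) ℝ) : 0 ≤ maxRowSum M :=
  Real.iSup_nonneg fun _ => Finset.sum_nonneg fun _ _ => abs_nonneg _

theorem sum_abs_row_mul_le (M : Matrix (Fin r) (Fin s) ℝ) (P : Matrix (Fin s) (Fin k) ℝ)
    (i : Fin r) : ∑ j, |(M * P) i j| ≤ (∑ l, |M i l|) * maxRowSum P := by
  calc ∑ j, |(M * P) i j| ≤ ∑ j, ∑ l, |M i l| * |P l j| := by
        refine Finset.sum_le_sum fun j _ => ?_
        rw [Matrix.mul_apply]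
        refine (Finset.abs_sum_le_sum_abs _ _).trans (le_of_eq ?_)
        exact Finset.sum_congr rfl fun l _ => abs_mul _ _
    _ = ∑ l, |M i l| * ∑ j, |P l j| := by
        rw [Finset.sum_comm]; simp only [Finset.mul_sum]
    _ ≤ _ := by
        rw [Finset.sum_mul]
        gcongr with l
        exact sum_abs_row_le_maxRowSum P l

end MaxRowSum

section Stable

variable {n p m : ℕ} {sys : LinSys n p m} {c ρ : ℝ}

/-- The case `τ = 1` of the stability estimate forces `ρ ≥ 0`. -/
theorem LTI.LinSys.IsStable.rate_nonneg (h : sys.IsStable c ρ) : 0 ≤ ρ := by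
  have h1 := (maxRowSum_nonneg _).trans (h.norm_pow_A 1)
  rw [pow_one] at h1
  exact nonneg_of_mul_nonneg_right h1 (by linarith [h.one_le])

theorem LTI.LinSys.IsStable.sum_abs_row_C_mul_pow_A_le (h : sys.IsStable c ρ) (i : Fin m) (d : ℕ) :
    ∑ a, |(sys.C * sys.A ^ d) i a| ≤ maxRowSum sys.C * c * ρ ^ d := by
  rw [mul_assoc]
  exact (sum_abs_row_mul_le _ _ i).trans
    (mul_le_mul (sum_abs_row_le_maxRowSum _ i) (h.norm_pow_A d) (maxRowSum_nonneg _)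
      (maxRowSum_nonneg _))

theorem LTI.LinSys.IsStable.sum_abs_row_markov_succ_le (h : sys.IsStable c ρ) (i : Fin m) (d : ℕ) :
    ∑ j, |sys.markov (d + 1) i j| ≤ maxRowSum sys.C * c ^ 2 * ρ ^ d := by
  have hc : 0 ≤ c := by linarith [h.one_le]
  calc _ ≤ (∑ a, |(sys.C * sys.A ^ d) i a|) * maxRowSum sys.B := sum_abs_row_mul_le _ _ i
    _ ≤ (maxRowSum sys.C * c * ρ ^ d) * c :=
      mul_le_mul (h.sum_abs_row_C_mul_pow_A_le i d) h.norm_B (maxRowSum_nonneg _)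
        (mul_nonneg (mul_nonneg (maxRowSum_nonneg _) hc) (pow_nonneg h.rate_nonneg _))
    _ = _ := by ring

theorem sum_pow_le_of_injOn {κ : Type*} (F : Finset κ) (f : κ → ℕ) (hf : Set.InjOn f F) {ρ : ℝ}
    (h0 : 0 ≤ ρ) (h1 : ρ < 1) : ∑ a ∈ F, ρ ^ f a ≤ 1 / (1 - ρ) := by
  rw [← Finset.sum_image (f := fun k => ρ ^ k) hf, one_div, ← tsum_geometric_of_lt_one h0 h1]
  exact (summable_geometric_of_lt_one h0 h1).sum_le_tsum _ fun _ _ => by positivity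

/-- The sum of the absolute values of a row of `[M₀ M₁ … M_{T-1}]`. -/
theorem LTI.LinSys.IsStable.sum_abs_markov_le (h : sys.IsStable c ρ) (T : ℕ) (i : Fin m) :
    ∑ q : Fin T × Fin p, |sys.markov q.1 i q.2| ≤ 2 * (c ^ 3 / (1 - ρ)) := by
  have hc := h.one_le
  have hρ : 0 < 1 - ρ := by linarith [h.lt_one]
  have hmarkov : ∀ k : ℕ, ∑ j, |sys.markov (k + 1) i j| ≤ c ^ 3 * ρ ^ k := fun k =>
    (h.sum_abs_row_markov_succ_le i k).trans (by
      have := h.norm_C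
      have := pow_nonneg h.rate_nonneg k
      calc maxRowSum sys.C * c ^ 2 * ρ ^ k ≤ c * c ^ 2 * ρ ^ k := by gcongr
        _ = _ := by ring)
  have h3 : c ≤ c ^ 3 / (1 - ρ) := by
    rw [le_div_iff₀ hρ]
    calc c * (1 - ρ) ≤ c * 1 := by gcongr; linarith [h.rate_nonneg]
      _ ≤ c * c ^ 2 := by gcongr; exact one_le_pow₀ hc
      _ = _ := by ring
  rw [Fintype.sum_prod_type, Fin.sum_univ_eq_sum_range (fun k => ∑ j, |sys.markov k i j|)]
  calc ∑ k ∈ Finset.range T, ∑ j, |sys.markov k i j|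
      ≤ ∑ k ∈ Finset.range (T + 1), ∑ j, |sys.markov k i j| :=
        Finset.sum_le_sum_of_subset_of_nonneg (Finset.range_mono (Nat.le_succ T))
          fun _ _ _ => Finset.sum_nonneg fun _ _ => abs_nonneg _
    _ = ∑ k ∈ Finset.range T, ∑ j, |sys.markov (k + 1) i j| + ∑ j, |sys.D i j| := by
        rw [Finset.sum_range_succ']; rfl
    _ ≤ ∑ k ∈ Finset.range T, c ^ 3 * ρ ^ k + c := by
        gcongr with k
        · exact hmarkov k
        · exact (sum_abs_row_le_maxRowSum _ i).trans h.norm_D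
    _ ≤ c ^ 3 * (1 / (1 - ρ)) + c := by
        rw [← Finset.mul_sum]
        gcongr
        exact sum_pow_le_of_injOn _ id (Function.injective_id.injOn) h.rate_nonneg h.lt_one
    _ ≤ _ := by rw [mul_one_div]; linarith

end Stable

section Kernel

variable {α : Type*} [Fintype α] {L : ℕ}

/-- The weight with which the input `a.2` at time `a.1 < L` enters the output at time `t` of the
strictly causal convolution with impulse response `κ`. -/
def causalKernel (L : ℕ) (κ : ℕ → α → ℝ) (t : ℕ) (a : Fin L × α) : ℝ :=
  if (a.1 : ℕ) < t then κ (t - 1 - a.1) a.2 else 0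

variable {κ : ℕ → α → ℝ} {β ρ : ℝ}

theorem sum_abs_causalKernel_le (hβ : 0 ≤ β) (h0 : 0 ≤ ρ) (h1 : ρ < 1)
    (hκ : ∀ d, ∑ a, |κ d a| ≤ β * ρ ^ d) (t : ℕ) :
    ∑ a, |causalKernel L κ t a| ≤ β / (1 - ρ) := by
  rw [Fintype.sum_prod_type]
  calc ∑ s : Fin L, ∑ a, |causalKernel L κ t (s, a)|
      ≤ ∑ s : Fin L, if (s : ℕ) < t then β * ρ ^ (t - 1 - s) else 0 := by
        refine Finset.sum_le_sum fun s _ => ?_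
        by_cases h : (s : ℕ) < t
        · simpa [causalKernel, h] using hκ (t - 1 - s)
        · simp [causalKernel, h]
    _ = β * ∑ s ∈ Finset.univ.filter (fun s : Fin L => (s : ℕ) < t), ρ ^ (t - 1 - s : ℕ) := by
        rw [← Finset.sum_filter, Finset.mul_sum]
    _ ≤ β * (1 / (1 - ρ)) := by
        gcongr
        refine sum_pow_le_of_injOn _ _ ?_ h0 h1
        intro a ha b hb hab
        simp only [Finset.coe_filter, Finset.mem_univ, true_and, Set.mem_ofPred_eq] at ha hb hab
        exact Fin.ext (by omega)
    _ = _ := by ring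

theorem sum_abs_causalKernel_apply_le {R : Type*} [Fintype R] {τ : R → ℕ}
    (hτ : Function.Injective τ) (hβ : 0 ≤ β) (h0 : 0 ≤ ρ) (h1 : ρ < 1)
    (hκ : ∀ d, ∑ a, |κ d a| ≤ β * ρ ^ d) (a : Fin L × α) :
    ∑ r, |causalKernel L κ (τ r) a| ≤ β / (1 - ρ) := by
  calc ∑ r, |causalKernel L κ (τ r) a|
      ≤ ∑ r, if (a.1 : ℕ) < τ r then β * ρ ^ (τ r - 1 - a.1) else 0 := by
        refine Finset.sum_le_sum fun r _ => ?_
        by_cases h : (a.1 : ℕ) < τ r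
        · simp only [causalKernel, h, if_true]
          exact (Finset.single_le_sum (f := fun b => |κ (τ r - 1 - a.1) b|)
            (fun _ _ => abs_nonneg _) (Finset.mem_univ a.2)).trans (hκ _)
        · simp [causalKernel, h]
    _ = β * ∑ r with (a.1 : ℕ) < τ r, ρ ^ (τ r - 1 - a.1) := by
        rw [← Finset.sum_filter, Finset.mul_sum]
    _ ≤ β * (1 / (1 - ρ)) := by
        gcongr
        refine sum_pow_le_of_injOn _ _ ?_ h0 h1
        intro r hr r' hr' hrr
        simp only [Finset.coe_filter, Finset.mem_univ, true_and, Set.mem_ofPred_eq] at hr hr' hrr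
        exact hτ (by omega)
    _ = _ := by ring

theorem sum_causalKernel_mul {t : ℕ} (ht : t ≤ L) (x : ℕ → α → ℝ) :
    ∑ a, causalKernel L κ t a * x a.1 a.2
      = ∑ s ∈ Finset.range t, ∑ a, κ (t - 1 - s) a * x s a := by
  rw [Fintype.sum_prod_type]
  have h : ∀ s : Fin L, ∑ a, causalKernel L κ t (s, a) * x s a
      = (fun s : ℕ => if s < t then ∑ a, κ (t - 1 - s) a * x s a else 0) s := by
    intro s
    by_cases h : (s : ℕ) < t <;> simp [causalKernel, h]
  simp only [h]
  rw [Fin.sum_univ_eq_sum_range (fun s : ℕ => if s < t then ∑ a, κ (t - 1 - s) a * x s a else 0),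
    ← Finset.sum_filter]
  congr 1
  ext s; simp; omega

end Kernel

theorem sq_sum_mul_le {ι : Type*} (s : Finset ι) (k x : ι → ℝ) :
    (∑ i ∈ s, k i * x i) ^ 2 ≤ (∑ i ∈ s, |k i|) * ∑ i ∈ s, |k i| * x i ^ 2 := by
  refine Finset.sum_sq_le_sum_mul_sum_of_sq_le_mul s (fun _ _ => abs_nonneg _)
    (fun _ _ => mul_nonneg (abs_nonneg _) (sq_nonneg _)) fun i _ => le_of_eq ?_
  rw [mul_pow, ← sq_abs (k i)]; ring

/-- The half of Schur's test that keeps the column sums of the kernel as weights. -/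
theorem sum_sq_sum_mul_le {R α : Type*} [Fintype R] [Fintype α] (k : R → α → ℝ) (x : α → ℝ)
    {H : ℝ} (hrow : ∀ r, ∑ a, |k r a| ≤ H) :
    ∑ r, (∑ a, k r a * x a) ^ 2 ≤ H * ∑ a, (∑ r, |k r a|) * x a ^ 2 := by
  calc ∑ r, (∑ a, k r a * x a) ^ 2 ≤ ∑ r, H * ∑ a, |k r a| * x a ^ 2 := by
        refine Finset.sum_le_sum fun r _ => (sq_sum_mul_le _ _ _).trans ?_
        exact mul_le_mul_of_nonneg_right (hrow r)
          (Finset.sum_nonneg fun _ _ => mul_nonneg (abs_nonneg _) (sq_nonneg _))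
    _ = _ := by
        rw [← Finset.mul_sum, Finset.sum_comm]; simp only [Finset.sum_mul]

/-- Schur's test: a kernel with row and column sums at most `H` has `ℓ²` operator norm at most
`H`. -/
theorem sum_sq_sum_mul_le_sq_mul {R α : Type*} [Fintype R] [Fintype α] (k : R → α → ℝ) (x : α → ℝ)
    {H : ℝ} (hH : 0 ≤ H) (hrow : ∀ r, ∑ a, |k r a| ≤ H) (hcol : ∀ a, ∑ r, |k r a| ≤ H) :
    ∑ r, (∑ a, k r a * x a) ^ 2 ≤ H ^ 2 * ∑ a, x a ^ 2 := by
  refine (sum_sq_sum_mul_le k x hrow).trans ?_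
  rw [sq H, mul_assoc]
  refine mul_le_mul_of_nonneg_left ?_ hH
  rw [Finset.mul_sum]
  exact Finset.sum_le_sum fun a _ => mul_le_mul_of_nonneg_right (hcol a) (sq_nonneg _)

section Output

variable {n p m : ℕ} (sys : LinSys n p m)

theorem LTI.LinSys.state_eq (u : ℕ → Fin p → ℝ) (w : ℕ → Fin n → ℝ) (t : ℕ) :
    sys.state u w t = ∑ s ∈ Finset.range t, sys.A ^ (t - 1 - s) *ᵥ (sys.B *ᵥ u s + w s) := by
  induction t with
  | zero => simp [LinSys.state]
  | succ t ih =>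
    rw [LinSys.state, ih, Finset.sum_range_succ, Matrix.mulVec_sum, add_assoc]
    congr 1
    · refine Finset.sum_congr rfl fun s hs => ?_
      have hs' : s < t := Finset.mem_range.1 hs
      rw [Matrix.mulVec_mulVec, ← pow_succ']
      congr 2; omega
    · simp

theorem LTI.LinSys.output_eq (u : ℕ → Fin p → ℝ) (w : ℕ → Fin n → ℝ) (v : ℕ → Fin m → ℝ) (t : ℕ)
    (i : Fin m) :
    sys.output u w v t i = ∑ k ∈ Finset.range (t + 1), ∑ j, sys.markov k i j * u (t - k) j
      + (∑ s ∈ Finset.range t, ∑ a, (sys.C * sys.A ^ (t - 1 - s)) i a * w s a + v t i) := by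
  have h1 : (sys.C *ᵥ sys.state u w t) i
      = ∑ s ∈ Finset.range t, ∑ j, sys.markov (t - 1 - s + 1) i j * u s j
        + ∑ s ∈ Finset.range t, ∑ a, (sys.C * sys.A ^ (t - 1 - s)) i a * w s a := by
    rw [LinSys.state_eq, Matrix.mulVec_sum, Finset.sum_apply, ← Finset.sum_add_distrib]
    refine Finset.sum_congr rfl fun s _ => ?_
    rw [Matrix.mulVec_mulVec, Matrix.mulVec_add, Matrix.mulVec_mulVec]
    rfl
  have h2 : ∑ s ∈ Finset.range t, ∑ j, sys.markov (t - 1 - s + 1) i j * u s j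
      = ∑ k ∈ Finset.range t, ∑ j, sys.markov (k + 1) i j * u (t - (k + 1)) j := by
    rw [← Finset.sum_range_reflect]
    refine Finset.sum_congr rfl fun k hk => ?_
    have : k < t := Finset.mem_range.1 hk
    have e1 : t - 1 - (t - 1 - k) = k := by omega
    have e2 : t - (k + 1) = t - 1 - k := by omega
    rw [e1, e2]
  rw [Finset.sum_range_succ', ← h2]
  change (sys.C *ᵥ sys.state u w t) i + (sys.D *ᵥ u t) i + v t i = _
  rw [h1]
  simp only [LinSys.markov, Nat.sub_zero]
  rw [Matrix.mulVec, dotProduct]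
  ring

/-- The residual of the true Markov parameters over the window: the response to inputs older than
the memory `T`, the full response to the process noise, and the measurement noise. -/
theorem LTI.LinSys.output_sub_eq {T N : ℕ} (hT : 0 < T) (u : ℕ → Fin p → ℝ) (w : ℕ → Fin n → ℝ)
    (v : ℕ → Fin m → ℝ) (r : Fin N) (i : Fin m) :
    sys.output u w v (T - 1 + r) i
        - ∑ q : Fin T × Fin p, sys.markov q.1 i q.2 * stackedInput T u (T - 1 + r) q
      = ∑ a, causalKernel (T + N - 1) (fun d => sys.markov (T + d) i) r a * u a.1 a.2
        + (∑ a, causalKernel (T + N - 1) (fun d => (sys.C * sys.A ^ d) i) (T - 1 + r) a * w a.1 a.2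
          + v (T - 1 + r) i) := by
  have hr := r.2
  rw [sum_causalKernel_mul (by omega) u, sum_causalKernel_mul (by omega) w, LinSys.output_eq,
    Fintype.sum_prod_type]
  simp only [stackedInput]
  rw [Fin.sum_univ_eq_sum_range (fun k => ∑ j, sys.markov k i j * u (T - 1 + r - k) j)]
  have h1 : T - 1 + (r : ℕ) + 1 = T + r := by omega
  rw [h1, Finset.sum_range_add, ← Finset.sum_range_reflect (n := (r : ℕ))]
  have h2 : ∀ k ∈ Finset.range (r : ℕ),
      ∑ j, sys.markov (T + (r - 1 - k)) i j * u (T - 1 + r - (T + (r - 1 - k))) j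
      = ∑ j, sys.markov (T + (r - 1 - k)) i j * u k j := by
    intro k hk
    have : k < r := Finset.mem_range.1 hk
    have e : T - 1 + (r : ℕ) - (T + (r - 1 - k)) = k := by omega
    rw [e]
  rw [Finset.sum_congr rfl h2]
  ring

end Output

/-! ### Deviation bounds for the noise model -/

section Events

variable {n p m T N : ℕ} {Ω : Type*} [MeasurableSpace Ω] {μ : Measure Ω}
  {u : ℕ → Ω → Fin p → ℝ} {w : ℕ → Ω → Fin n → ℝ} {v : ℕ → Ω → Fin m → ℝ} {σu σw σv : ℝ≥0}

theorem LTI.IsNoiseModel.aemeasurable {L : ℕ} (h : IsNoiseModel μ L u w v σu σw σv)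
    (s : (Fin L × Fin p) ⊕ (Fin L × Fin n) ⊕ (Fin L × Fin m)) :
    AEMeasurable (fun ω : Ω => match s with
      | .inl (t, j) => u t ω j
      | .inr (.inl (t, i)) => w t ω i
      | .inr (.inr (t, i)) => v t ω i) μ := by
  rcases s with ⟨t, j⟩ | ⟨t, i⟩ | ⟨t, i⟩
  · exact (h.input_law t t.2 j).aemeasurable
  · exact (h.process_subgaussian t t.2 i).aemeasurable
  · exact (h.measurement_subgaussian t t.2 i).aemeasurable

variable [IsProbabilityMeasure μ]

/-- The time step `T - 1 + r - k` of the `k`-th block of the `r`-th stacked input. -/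
def inputTime (T N : ℕ) (r : Fin N) (k : Fin T) : Fin (T + N - 1) :=
  ⟨T - 1 + r - k, by have := r.2; have := k.2; omega⟩

theorem inputTime_injective (k : Fin T) :
    Function.Injective fun r : Fin N => inputTime T N r k := by
  intro r r' hr
  have := k.2
  simp only [inputTime, Fin.mk.injEq] at hr
  exact Fin.ext (by omega)

theorem LTI.IsNoiseModel.measure_gram_diag_le (h : IsNoiseModel μ (T + N - 1) u w v σu σw σv)
    (hσ : 0 < σu) {l q : ℝ} (hq0 : 0 ≤ q) (hq1 : q ≤ 1) (hq : 8 * l ≤ N * q ^ 2)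
    (a : Fin T × Fin p) :
    μ {ω | N * σu ^ 2 * q
        ≤ |∑ r : Fin N, stackedInput T (fun t => u t ω) (T - 1 + r) a ^ 2 - N * σu ^ 2|}
      ≤ 2 * ENNReal.ofReal (Real.exp (-l)) := by
  have := measure_abs_sum_sq_gaussian_le h.indep h.aemeasurable
    (fun r : Fin N => .inl (inputTime T N r a.1, a.2))
    (fun r r' hr => inputTime_injective a.1 (by simpa using hr)) hσ
    (fun r => h.input_law _ (inputTime T N r a.1).2 a.2) (l := l) hq0 hq1 (by simpa using hq)
  simp only [Fintype.card_fin] at this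
  exact this

/-- Two distinct columns of the design are nearly orthogonal. Both columns may be built from the
same scalar input at different lags; the factor with the smaller lag is the more recent one, so the
other factor is a predictable coefficient. -/
theorem LTI.IsNoiseModel.measure_gram_offDiag_le (h : IsNoiseModel μ (T + N - 1) u w v σu σw σv)
    {l θ : ℝ} (hθ : 0 < θ) {a b : Fin T × Fin p} (hab : a.1 ≤ b.1) (hne : a ≠ b) :
    μ {ω | l / θ + θ / 2 *
          ∑ r : Fin N, σu ^ 2 * stackedInput T (fun t => u t ω) (T - 1 + r) b ^ 2
        ≤ |∑ r : Fin N, stackedInput T (fun t => u t ω) (T - 1 + r) b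
            * stackedInput T (fun t => u t ω) (T - 1 + r) a|}
      ≤ 2 * ENNReal.ofReal (Real.exp (-l)) := by
  have := measure_abs_selfNormalized_le h.indep h.aemeasurable
    (fun r : Fin N => .inl (inputTime T N r a.1, a.2))
    (fun r r' hr => inputTime_injective a.1 (by simpa using hr)) (fun r => r) (fun _ => σu ^ 2)
    (fun r => (h.input_law _ (inputTime T N r a.1).2 a.2).hasSubgaussianMGF_gaussian)
    (fun r x => x (.inl (inputTime T N r b.1, b.2))) (fun r => by fun_prop) ?_ l hθ
  · simp only [NNReal.coe_pow] at this
    exact this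
  · intro r r' hr x y hxy
    refine hxy _ fun heq => ?_
    simp only [Sum.inl.injEq, Prod.mk.injEq, inputTime, Fin.mk.injEq] at heq
    have h1 := a.1.2
    have h2 := b.1.2
    have h3 : (a.1 : ℕ) ≤ b.1 := hab
    exact hne (Prod.ext (Fin.ext (by omega)) heq.2.symm)

/-- Conditionally on the inputs, the correlation of the noise with a column of the design is
linear in independent sub-Gaussian variables. -/
theorem LTI.IsNoiseModel.measure_noise_le (h : IsNoiseModel μ (T + N - 1) u w v σu σw σv)
    {l θ : ℝ} (hθ : 0 < θ) (K : Fin N → Fin (T + N - 1) × Fin n → ℝ) (i : Fin m)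
    (a : Fin T × Fin p) :
    μ {ω | l / θ + θ / 2 *
          (σw ^ 2 * ∑ s, (∑ r, K r s * stackedInput T (fun t => u t ω) (T - 1 + r) a) ^ 2
            + σv ^ 2 * ∑ r : Fin N, stackedInput T (fun t => u t ω) (T - 1 + r) a ^ 2)
        ≤ |∑ r : Fin N, (∑ s, K r s * w s.1 ω s.2 + v (T - 1 + r) ω i)
            * stackedInput T (fun t => u t ω) (T - 1 + r) a|}
      ≤ 2 * ENNReal.ofReal (Real.exp (-l)) := by
  have hlt : ∀ r : Fin N, T - 1 + (r : ℕ) < T + N - 1 := fun r => by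
    have := r.2; have := a.1.2; omega
  have := measure_abs_selfNormalized_le h.indep h.aemeasurable
    (κ := (Fin (T + N - 1) × Fin n) ⊕ Fin N)
    (Sum.elim (fun s => .inr (.inl s)) (fun r => .inr (.inr (⟨T - 1 + r, hlt r⟩, i))))
    ?_ (fun _ => 0) (Sum.elim (fun _ => σw ^ 2) (fun _ => σv ^ 2)) ?_
    (Sum.elim (fun s x => ∑ r, K r s * x (.inl (inputTime T N r a.1, a.2)))
      (fun r x => x (.inl (inputTime T N r a.1, a.2)))) ?_ ?_ l hθ
  · refine le_trans (measure_mono fun ω hω => ?_) this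
    simp only [Set.mem_ofPred_eq, Fintype.sum_sum_type, Sum.elim_inl, Sum.elim_inr,
      NNReal.coe_pow, ← Finset.mul_sum] at hω ⊢
    refine hω.trans (le_of_eq ?_)
    congr 1
    simp only [add_mul, Finset.sum_add_distrib, Finset.sum_mul]
    rw [Finset.sum_comm]
    congr 1
    · exact Finset.sum_congr rfl fun s _ => Finset.sum_congr rfl fun r _ => mul_right_comm _ _ _
    · exact Finset.sum_congr rfl fun r _ => mul_comm _ _
  · rintro (s | r) (s' | r') hh
    · simpa using hh
    · simp at hh
    · simp at hh
    · simp only [Sum.elim_inr, Sum.inr.injEq, Prod.mk.injEq, Fin.mk.injEq, and_true] at hh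
      congr 1
      exact Fin.ext (by omega)
  · rintro (s | r)
    · exact h.process_subgaussian s.1 s.1.2 s.2
    · exact h.measurement_subgaussian (T - 1 + r) (hlt r) i
  · rintro (s | r)
    · simp only [Sum.elim_inl]; fun_prop
    · simp only [Sum.elim_inr]; fun_prop
  · rintro (s | r) (s' | r') - x y hxy
    all_goals simp only [Sum.elim_inl, Sum.elim_inr] at hxy ⊢
    · exact Finset.sum_congr rfl fun r _ => by rw [hxy _ (by simp)]
    · exact hxy _ (by simp)
    · exact Finset.sum_congr rfl fun r _ => by rw [hxy _ (by simp)]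
    · exact hxy _ (by simp)

theorem LTI.IsNoiseModel.measure_tail_le (h : IsNoiseModel μ (T + N - 1) u w v σu σw σv)
    (hσ : 0 < σu) (K : Fin N → Fin (T + N - 1) × Fin p → ℝ) {H : ℝ} (hH : 0 < H)
    (hrow : ∀ r, ∑ s, |K r s| ≤ H) (hcol : ∀ s, ∑ r, |K r s| ≤ H) :
    μ {ω | 3 * σu ^ 2 * N * H ≤ ∑ s, (∑ r, |K r s|) * u s.1 ω s.2 ^ 2}
      ≤ ENNReal.ofReal (Real.exp (-(3 * N / 8))) := by
  refine measure_weighted_sum_sq_gaussian_le h.indep h.aemeasurable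
    (fun s : Fin (T + N - 1) × Fin p => .inl s) Sum.inl_injective hσ
    (fun s => h.input_law s.1 s.1.2 s.2) (fun s => ∑ r, |K r s|) hH
    (fun s => Finset.sum_nonneg fun _ _ => abs_nonneg _) hcol ?_
  rw [Finset.sum_comm]
  calc ∑ r, ∑ s, |K r s| ≤ ∑ r : Fin N, H := Finset.sum_le_sum fun r _ => hrow r
    _ = _ := by simp

end Events

/-! ### Deterministic estimates and rates -/

section Deterministic

/-- The Gram matrix of the design is entrywise close to `N σ²` times the identity. Pairs
of columns need to be controlled in one order only, that of increasing lag `ord`. -/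
theorem abs_gram_sub_le {R Q : Type*} [Fintype R] [DecidableEq Q] (φ : R → Q → ℝ) (ord : Q → ℕ)
    {N : ℕ} {σ l : ℝ} (hσ : 0 < σ) (hl : 0 < l) (hN : 8 * l ≤ N)
    (hD : ∀ a, |∑ r, φ r a ^ 2 - N * σ ^ 2| < N * σ ^ 2 * √(8 * l / N))
    (hO : ∀ a b, ord a ≤ ord b → a ≠ b → |∑ r, φ r b * φ r a|
      < l / (√(l / N) / σ ^ 2) + √(l / N) / σ ^ 2 / 2 * ∑ r, σ ^ 2 * φ r b ^ 2) :
    (∀ a, ∑ r, φ r a ^ 2 ≤ 2 * N * σ ^ 2) ∧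
    ∀ a b, |∑ r, φ r a * φ r b - (if a = b then N * σ ^ 2 else 0)|
      ≤ N * (3 * σ ^ 2 * √(l / N)) := by
  have hN0 : (0 : ℝ) < N := by linarith
  have hq1 : √(8 * l / N) ≤ 1 := by
    rw [Real.sqrt_le_one]; exact (div_le_one hN0).2 hN
  -- `8 ≤ 3²`
  have hq3 : √(8 * l / N) ≤ 3 * √(l / N) := by
    rw [Real.sqrt_le_left (by positivity), mul_pow, Real.sq_sqrt (by positivity), mul_div_assoc]
    have : 0 < l / N := by positivity
    linarith
  have hsum : ∀ a, ∑ r, φ r a ^ 2 ≤ 2 * N * σ ^ 2 := by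
    intro a
    have h1 := (le_abs_self _).trans (hD a).le
    have h2 : N * σ ^ 2 * √(8 * l / N) ≤ N * σ ^ 2 * 1 := by gcongr
    linarith
  refine ⟨hsum, ?_⟩
  have hoff : ∀ a b, ord a ≤ ord b → a ≠ b → |∑ r, φ r b * φ r a|
      ≤ N * (3 * σ ^ 2 * √(l / N)) := by
    intro a b hab hne
    refine (hO a b hab hne).le.trans ?_
    rw [← Finset.mul_sum]
    set x := √(l / N) with hx
    have hx0 : 0 < x := Real.sqrt_pos.2 (by positivity)
    have hlx : l = N * x ^ 2 := by
      rw [hx, Real.sq_sqrt (by positivity)]; field_simp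
    have e1 : l / (x / σ ^ 2) = N * σ ^ 2 * x := by
      rw [hlx]; field_simp
    have e2 : x / σ ^ 2 / 2 * (σ ^ 2 * ∑ r, φ r b ^ 2) = x / 2 * ∑ r, φ r b ^ 2 := by
      field_simp
    have e3 : x / 2 * ∑ r, φ r b ^ 2 ≤ x / 2 * (2 * N * σ ^ 2) := by
      gcongr; exact hsum b
    have e4 : 0 < N * σ ^ 2 * x := by positivity
    rw [e1, e2]
    linarith
  intro a b
  by_cases hab : a = b
  · subst hab
    simp only [if_true, ← sq]
    refine (hD a).le.trans ?_
    calc N * σ ^ 2 * √(8 * l / N) ≤ N * σ ^ 2 * (3 * √(l / N)) := by gcongr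
      _ = _ := by ring
  · simp only [hab, if_false, sub_zero]
    rcases le_total (ord a) (ord b) with h | h
    · simpa only [mul_comm] using hoff a b h hab
    · exact hoff b a h (Ne.symm hab)

/-- The threshold `l / θ + θ / 2 * V` of the self-normalized bound at `θ = l / (N R)`. The summand
`ε` in `R` keeps `θ` finite when the noise level `τ` vanishes. -/
theorem selfNormalized_threshold_le {N σ τ l ε V : ℝ} (hN : 0 < N) (hσ : 0 < σ) (hτ : 0 ≤ τ)
    (hl : 0 < l) (hε : 0 < ε) (hV : V ≤ τ ^ 2 * (2 * N * σ ^ 2)) {R : ℝ}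
    (hR : R = σ * τ * √(l / N) + ε) :
    l / (l / (N * R)) + l / (N * R) / 2 * V ≤ 2 * N * R := by
  have hR0 : 0 < R := by rw [hR]; positivity
  have h1 : σ * τ * √(l / N) ≤ R := by rw [hR]; linarith
  have h2 : (σ * τ) ^ 2 * (l / N) ≤ R ^ 2 := by
    have := pow_le_pow_left₀ (by positivity) h1 2
    rwa [mul_pow, Real.sq_sqrt (by positivity)] at this
  have e1 : l / (l / (N * R)) = N * R := by field_simp
  have h3 : l / (N * R) / 2 * V ≤ N * R := by
    calc l / (N * R) / 2 * V ≤ l / (N * R) / 2 * (τ ^ 2 * (2 * N * σ ^ 2)) := by gcongr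
      _ = N / R * ((σ * τ) ^ 2 * (l / N)) := by field_simp
      _ ≤ N / R * R ^ 2 := by gcongr
      _ = _ := by field_simp
  linarith

/-- The correlation with a column of the design of a signal `t` of mean square at most `3 σ² ε²`. -/
theorem abs_sum_mul_le_of_tail {R : Type*} [Fintype R] (t φ : R → ℝ) {N σ ε : ℝ} (hN : 0 ≤ N)
    (hε : 0 ≤ ε) (ht : ∑ r, t r ^ 2 ≤ ε * (3 * σ ^ 2 * N * ε))
    (hφ : ∑ r, φ r ^ 2 ≤ 2 * N * σ ^ 2) : |∑ r, t r * φ r| ≤ N * (3 * σ ^ 2 * ε) := by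
  refine abs_le_of_sq_le_sq ?_ (by positivity)
  calc (∑ r, t r * φ r) ^ 2 ≤ (∑ r, t r ^ 2) * ∑ r, φ r ^ 2 :=
        Finset.sum_mul_sq_le_sq_mul_sq _ _ _
    _ ≤ (ε * (3 * σ ^ 2 * N * ε)) * (2 * N * σ ^ 2) := by
        gcongr
    _ ≤ _ := by
        have : 0 ≤ (N * σ ^ 2 * ε) ^ 2 := sq_nonneg _
        nlinarith

end Deterministic

section Rates

theorem one_lt_log_three : 1 < Real.log 3 := by
  rw [Real.lt_log_iff_exp_lt (by norm_num)]
  linarith [Real.exp_one_lt_d9]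

theorem pow_le_exp_neg {ρ : ℝ} (h0 : 0 ≤ ρ) (k : ℕ) : ρ ^ k ≤ Real.exp (-((1 - ρ) * k)) := by
  have h1 : ρ ≤ Real.exp (-(1 - ρ)) := by
    have := Real.add_one_le_exp (-(1 - ρ)); linarith
  calc ρ ^ k ≤ Real.exp (-(1 - ρ)) ^ k := pow_le_pow_left₀ h0 h1 k
    _ = _ := by rw [← Real.exp_nat_mul]; congr 1; ring

/-- A memory length exceeding a multiple of `T₀` makes the truncated part of the impulse response
negligible. -/
theorem memory_length_bounds {n p T N : ℕ} {c ρ σw σv ε ε' Cn : ℝ} (hn : 0 < n) (hN : 0 < N)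
    (hTp : 2 ≤ T * p) (hc : 1 ≤ c) (h0 : 0 ≤ ρ) (h1 : ρ < 1) (hε : 0 < ε) (hε' : 0 < ε')
    (hCn : 0 ≤ Cn)
    (hT : (12 + 2 / Real.log (Real.log 3)) * max (T₀ n p T N c ρ σw σv ε)
        (Real.log (Cn / ε') / (1 - ρ)) ≤ T) :
    2 ≤ T ∧ c ^ 3 * ρ ^ (T - 1) / (1 - ρ) ≤ ε ∧ Cn * c ^ 2 * ρ ^ (T - 1) / (1 - ρ) ≤ ε' := by
  have hρ : 0 < 1 - ρ := by linarith
  set ll3 := Real.log (Real.log 3) with hll3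
  have hll3pos : 0 < ll3 := Real.log_pos one_lt_log_three
  set x := Real.log (c / (1 - ρ)) with hx
  have hcr : 1 ≤ c / (1 - ρ) := by rw [le_div_iff₀ hρ]; linarith
  have hx0 : 0 ≤ x := Real.log_nonneg hcr
  set y := Real.posLog (1 / ε) with hy
  have hy0 : 0 ≤ y := Real.posLog_nonneg
  have hs0 : 0 ≤ Real.posLog (σw + σv) := Real.posLog_nonneg
  have hlog : ll3 ≤ Real.log (Real.log (N * n + T * p)) := by
    have : (3 : ℝ) ≤ N * n + T * p := by
      have h3 : 1 ≤ N * n := Nat.mul_pos hN hn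
      have : 3 ≤ N * n + T * p := by omega
      exact_mod_cast this
    have h4 : Real.log 3 ≤ Real.log (N * n + T * p) := Real.log_le_log (by norm_num) this
    exact Real.log_le_log (by linarith [one_lt_log_three]) h4
  set P := max (T₀ n p T N c ρ σw σv ε * (1 - ρ)) (Real.log (Cn / ε')) with hP
  have hT' : (12 + 2 / ll3) * P ≤ T * (1 - ρ) := by
    have := mul_le_mul_of_nonneg_right hT hρ.le
    rwa [mul_assoc, max_mul_of_nonneg _ _ hρ.le, div_mul_cancel₀ _ hρ.ne'] at this
  have hP1 : ll3 + x + y ≤ P := by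
    refine le_trans ?_ (le_max_left _ _)
    rw [T₀, div_mul_cancel₀ _ hρ.ne']
    linarith
  have hP2 : Real.log (Cn / ε') ≤ P := le_max_right _ _
  have hP0 : 0 ≤ P := by linarith
  -- `T ≥ 2` because the double logarithm in `T₀` is at least `log (log 3) > 0`
  have hT2 : 2 ≤ T := by
    have h2 : 2 / ll3 * ll3 = 2 := div_mul_cancel₀ _ hll3pos.ne'
    have h3 : 2 / ll3 * ll3 ≤ 2 / ll3 * P := by gcongr; linarith
    have h4 : (T : ℝ) * (1 - ρ) ≤ T * 1 := by gcongr; linarith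
    have : (2 : ℝ) ≤ T := by linarith
    exact_mod_cast this
  have hpow : ρ ^ (T - 1) ≤ Real.exp (-(6 * P)) := by
    refine (pow_le_exp_neg h0 _).trans (Real.exp_le_exp.2 ?_)
    have h2 : (T : ℝ) / 2 ≤ ((T - 1 : ℕ) : ℝ) := by
      rw [Nat.cast_sub (by omega)]
      have : (2 : ℝ) ≤ T := by exact_mod_cast hT2
      push_cast; linarith
    have h3 := mul_le_mul_of_nonneg_left h2 hρ.le
    have h4 : 0 ≤ 2 / ll3 * P := by positivity
    linarith
  have hexp : Real.exp x = c / (1 - ρ) := Real.exp_log (by positivity)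
  have hpow0 : 0 ≤ ρ ^ (T - 1) := pow_nonneg h0 _
  have hinv : 1 ≤ 1 / (1 - ρ) := by rw [le_div_iff₀ hρ]; linarith
  refine ⟨hT2, ?_, ?_⟩
  · have h2 : c ^ 3 / (1 - ρ) ≤ Real.exp (3 * x) := by
      have : Real.exp (3 * x) = Real.exp x ^ 3 := by rw [← Real.exp_nat_mul]; norm_num
      rw [this, hexp, div_pow]
      have : (1 - ρ) ^ 3 ≤ 1 - ρ := pow_le_of_le_one hρ.le (by linarith) (by norm_num)
      gcongr
    have h3 : Real.exp (-y) ≤ ε := by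
      rw [← Real.le_log_iff_exp_le hε]
      have : Real.log (1 / ε) ≤ y := le_max_right _ _
      rw [one_div, Real.log_inv] at this
      linarith
    calc c ^ 3 * ρ ^ (T - 1) / (1 - ρ) = c ^ 3 / (1 - ρ) * ρ ^ (T - 1) := by ring
      _ ≤ Real.exp (3 * x) * Real.exp (-(6 * P)) := by gcongr
      _ ≤ Real.exp (-y) := by
        rw [← Real.exp_add]; exact Real.exp_le_exp.2 (by linarith)
      _ ≤ ε := h3
  · have h2 : c ^ 2 / (1 - ρ) ≤ Real.exp (2 * x) := by
      have : Real.exp (2 * x) = Real.exp x ^ 2 := by rw [← Real.exp_nat_mul]; norm_num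
      rw [this, hexp, div_pow]
      have : (1 - ρ) ^ 2 ≤ 1 - ρ := pow_le_of_le_one hρ.le (by linarith) (by norm_num)
      gcongr
    have h3 : Cn ≤ ε' * Real.exp P := by
      rcases hCn.eq_or_lt with h | h
      · rw [← h]; positivity
      · have : Cn / ε' ≤ Real.exp P := (Real.log_le_iff_le_exp (by positivity)).1 hP2
        rw [div_le_iff₀ hε'] at this
        linarith
    calc Cn * c ^ 2 * ρ ^ (T - 1) / (1 - ρ) = Cn * (c ^ 2 / (1 - ρ) * ρ ^ (T - 1)) := by ring
      _ ≤ ε' * Real.exp P * (Real.exp (2 * x) * Real.exp (-(6 * P))) := by gcongr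
      _ = ε' * Real.exp (2 * x - 5 * P) := by
        rw [mul_assoc, ← Real.exp_add, ← Real.exp_add]; congr 2; ring
      _ ≤ ε' * 1 := by
        gcongr; rw [Real.exp_le_one_iff]; linarith
      _ = ε' := mul_one _

theorem rpow_quarter_sq {z : ℝ} (hz : 0 ≤ z) : (z ^ (1 / 4 : ℝ)) ^ 2 = √z := by
  rw [← Real.rpow_natCast, ← Real.rpow_mul hz, Real.sqrt_eq_rpow]; norm_num

/-- The squared slow rate `‖G‖₁ λ / σu²` is controlled by `err₁`; the factor `S²` makes up for the
higher power of `σu` in the denominators of `err₁`. -/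
theorem lambdaScale_le_err₁_sq {n p T N : ℕ} {c ρ σu σw σv ε S : ℝ} (hc : 0 ≤ c) (hρ : ρ < 1)
    (hσ : 0 < σu) (hS : σu ≤ S) (hσw : 0 ≤ σw) (hσv : 0 ≤ σv) (hε : 0 ≤ ε)
    (hlog : 0 ≤ Real.log (T * p * n)) :
    c ^ 3 / (1 - ρ) * lambdaScale n p T N c ρ σu σw σv ε / σu ^ 2
      ≤ S ^ 2 * err₁ n p T N c ρ σu σw σv ε ^ 2 := by
  have h1 : 0 < 1 - ρ := by linarith
  have hτ : 0 ≤ effNoise c ρ σw + σv := by unfold effNoise; positivity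
  rw [err₁, lambdaScale]
  set τ := effNoise c ρ σw + σv
  set z := Real.log (T * p * n) / N with hz
  have hz0 : 0 ≤ z := by positivity
  have h2 : ∀ a b : ℝ, 0 ≤ a → 0 ≤ b → a ^ 2 + b ^ 2 ≤ (a + b) ^ 2 := fun a b ha hb => by
    nlinarith [mul_nonneg ha hb]
  have h3 := h2 (√(τ / σu ^ 3) * z ^ (1 / 4 : ℝ)) (√ε / σu ^ 2) (by positivity) (by positivity)
  rw [mul_pow, rpow_quarter_sq hz0, Real.sq_sqrt (by positivity), div_pow, Real.sq_sqrt hε] at h3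
  rw [mul_pow, Real.sq_sqrt (by positivity)]
  calc c ^ 3 / (1 - ρ) * (σu * τ * √z + ε) / σu ^ 2
      = σu ^ 2 * (c ^ 3 / (1 - ρ) * (τ / σu ^ 3 * √z + ε / (σu ^ 2) ^ 2)) := by field_simp
    _ ≤ S ^ 2 * (c ^ 3 / (1 - ρ) * (τ / σu ^ 3 * √z + ε / (σu ^ 2) ^ 2)) := by gcongr
    _ ≤ _ := by gcongr

theorem err₂_sq {p T N : ℕ} {c ρ : ℝ} (hlog : 0 ≤ Real.log (T * p)) :
    err₂ p T N c ρ ^ 2 = (c ^ 3 / (1 - ρ)) ^ 2 * √(Real.log (T * p) / N) := by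
  rw [err₂, mul_pow, rpow_quarter_sq (by positivity)]

end Rates

/-! ### The good event -/

section Assembly

variable {n p m T N : ℕ}

theorem sum_rowErr_eq (sys : LinSys n p m) (X : Matrix (Fin m) (Fin T × Fin p) ℝ) (i : Fin m) :
    ∑ k ∈ Finset.range T, rowErr sys X i k
      = ENNReal.ofReal (∑ q : Fin T × Fin p, (X i q - sys.markov q.1 i q.2) ^ 2) := by
  rw [ENNReal.ofReal_sum_of_nonneg (fun _ _ => sq_nonneg _), Fintype.sum_prod_type,
    ← Fin.sum_univ_eq_sum_range]
  refine Finset.sum_congr rfl fun k _ => Finset.sum_congr rfl fun j _ => ?_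
  rw [← ofReal_norm, ← ENNReal.ofReal_pow (norm_nonneg _), Real.norm_eq_abs, sq_abs,
    ← neg_sq]
  simp [estimatedMarkov]

theorem rowErr_tail_le {sys : LinSys n p m} {c ρ : ℝ} (h : sys.IsStable c ρ) (hT : 0 < T)
    (X : Matrix (Fin m) (Fin T × Fin p) ℝ) (i : Fin m) (k : ℕ) :
    rowErr sys X i (T + k)
      ≤ ENNReal.ofReal ((maxRowSum sys.C * c ^ 2 * ρ ^ (T - 1)) ^ 2 * ρ ^ k) := by
  have h1 : rowErr sys X i (T + k) = ENNReal.ofReal (∑ j, |sys.markov (T + k) i j| ^ 2) := by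
    rw [ENNReal.ofReal_sum_of_nonneg (fun _ _ => sq_nonneg _)]
    refine Finset.sum_congr rfl fun j _ => ?_
    rw [← ofReal_norm, ← ENNReal.ofReal_pow (norm_nonneg _), Real.norm_eq_abs]
    simp [estimatedMarkov]
  rw [h1]
  refine ENNReal.ofReal_le_ofReal ?_
  have h0 := h.rate_nonneg
  have h2 : ∑ j, |sys.markov (T + k) i j| ≤ maxRowSum sys.C * c ^ 2 * ρ ^ (T - 1) * ρ ^ k := by
    have := h.sum_abs_row_markov_succ_le i (T - 1 + k)
    rw [pow_add, ← mul_assoc] at this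
    rwa [show T - 1 + k + 1 = T + k by omega] at this
  calc ∑ j, |sys.markov (T + k) i j| ^ 2 ≤ (∑ j, |sys.markov (T + k) i j|) ^ 2 :=
        Finset.sum_sq_le_sq_sum_of_nonneg fun _ _ => abs_nonneg _
    _ ≤ (maxRowSum sys.C * c ^ 2 * ρ ^ (T - 1) * ρ ^ k) ^ 2 :=
        pow_le_pow_left₀ (Finset.sum_nonneg fun _ _ => abs_nonneg _) h2 2
    _ = (maxRowSum sys.C * c ^ 2 * ρ ^ (T - 1)) ^ 2 * (ρ ^ k) ^ 2 := mul_pow _ _ _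
    _ ≤ _ := by
        gcongr
        exact pow_le_of_le_one (pow_nonneg h0 _) (pow_le_one₀ h0 h.lt_one.le) two_ne_zero

/-- The impulse response from the process noise to the `i`-th output, over the window. -/
def noiseKernel (T N : ℕ) (sys : LinSys n p m) (i : Fin m) (r : Fin N) :
    Fin (T + N - 1) × Fin n → ℝ :=
  causalKernel (T + N - 1) (fun d => (sys.C * sys.A ^ d) i) (T - 1 + r)

/-- The part of the impulse response from the input to the `i`-th output that lies beyond the
memory `T` of the regression. -/
def tailKernel (T N : ℕ) (sys : LinSys n p m) (i : Fin m) (r : Fin N) :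
    Fin (T + N - 1) × Fin p → ℝ :=
  causalKernel (T + N - 1) (fun d => sys.markov (T + d) i) r

variable {sys : LinSys n p m} {c ρ : ℝ}

theorem noiseKernel_bounds (h : sys.IsStable c ρ) (T N : ℕ) (i : Fin m) :
    (∀ r, ∑ a, |noiseKernel T N sys i r a| ≤ c ^ 2 / (1 - ρ)) ∧
      ∀ a, ∑ r, |noiseKernel T N sys i r a| ≤ c ^ 2 / (1 - ρ) := by
  have hc := h.one_le
  have hκ : ∀ d, ∑ a, |(sys.C * sys.A ^ d) i a| ≤ c ^ 2 * ρ ^ d := fun d =>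
    (h.sum_abs_row_C_mul_pow_A_le i d).trans (by
      have := h.norm_C
      have := pow_nonneg h.rate_nonneg d
      rw [sq]; gcongr)
  refine ⟨fun r => sum_abs_causalKernel_le (by positivity) h.rate_nonneg h.lt_one hκ _,
    fun a => sum_abs_causalKernel_apply_le (τ := fun r : Fin N => T - 1 + r) (fun r r' hr => ?_)
      (by positivity) h.rate_nonneg h.lt_one hκ a⟩
  exact Fin.ext (Nat.add_left_cancel hr)

theorem tailKernel_bounds (h : sys.IsStable c ρ) (hT : 0 < T) (N : ℕ) (i : Fin m) :
    (∀ r, ∑ a, |tailKernel T N sys i r a| ≤ c ^ 3 * ρ ^ (T - 1) / (1 - ρ)) ∧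
      ∀ a, ∑ r, |tailKernel T N sys i r a| ≤ c ^ 3 * ρ ^ (T - 1) / (1 - ρ) := by
  have hc := h.one_le
  have hβ : 0 ≤ c ^ 3 * ρ ^ (T - 1) := mul_nonneg (by positivity) (pow_nonneg h.rate_nonneg _)
  have hκ : ∀ d, ∑ a, |sys.markov (T + d) i a| ≤ c ^ 3 * ρ ^ (T - 1) * ρ ^ d := fun d => by
    have h1 := h.sum_abs_row_markov_succ_le i (T - 1 + d)
    rw [show T - 1 + d + 1 = T + d by omega] at h1
    refine h1.trans ?_
    have := h.norm_C
    have := pow_nonneg h.rate_nonneg (T - 1 + d)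
    calc maxRowSum sys.C * c ^ 2 * ρ ^ (T - 1 + d) ≤ c * c ^ 2 * ρ ^ (T - 1 + d) := by gcongr
      _ = _ := by rw [pow_add]; ring
  exact ⟨fun r => sum_abs_causalKernel_le hβ h.rate_nonneg h.lt_one hκ _,
    fun a => sum_abs_causalKernel_apply_le (τ := fun r : Fin N => (r : ℕ)) Fin.val_injective
      hβ h.rate_nonneg h.lt_one hκ a⟩

/-- The scale `σᵤ (σ̄w + σᵥ) √(l / N) + ε` of the correlation between residuals and inputs. -/
noncomputable def residualScale (N : ℕ) (c ρ σu σw σv ε l : ℝ) : ℝ :=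
  σu * (effNoise c ρ σw + σv) * √(l / N) + ε

/-- The four families of inequalities, satisfied with high probability, that drive the
deterministic analysis: the design has nearly orthogonal columns, the noise is nearly orthogonal to
the design, and the input before the memory window has bounded energy. -/
structure GoodEvent (T N : ℕ) (sys : LinSys n p m) (u : ℕ → Fin p → ℝ) (w : ℕ → Fin n → ℝ)
    (v : ℕ → Fin m → ℝ) (c ρ σu σw σv ε l : ℝ) : Prop where
  gram_diag : ∀ a, |∑ r : Fin N, stackedInput T u (T - 1 + r) a ^ 2 - N * σu ^ 2|
    < N * σu ^ 2 * √(8 * l / N)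
  gram_offDiag : ∀ a b : Fin T × Fin p, a.1 ≤ b.1 → a ≠ b →
    |∑ r : Fin N, stackedInput T u (T - 1 + r) b * stackedInput T u (T - 1 + r) a|
      < l / (√(l / N) / σu ^ 2)
        + √(l / N) / σu ^ 2 / 2 * ∑ r : Fin N, σu ^ 2 * stackedInput T u (T - 1 + r) b ^ 2
  noise : ∀ i a, |∑ r : Fin N, (∑ s, noiseKernel T N sys i r s * w s.1 s.2 + v (T - 1 + r) i)
      * stackedInput T u (T - 1 + r) a|
    < l / (l / (N * residualScale N c ρ σu σw σv ε l))
      + l / (N * residualScale N c ρ σu σw σv ε l) / 2 *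
        (σw ^ 2 * ∑ s, (∑ r, noiseKernel T N sys i r s * stackedInput T u (T - 1 + r) a) ^ 2
          + σv ^ 2 * ∑ r : Fin N, stackedInput T u (T - 1 + r) a ^ 2)
  tail : ∀ i, ∑ s, (∑ r, |tailKernel T N sys i r s|) * u s.1 s.2 ^ 2 < 3 * σu ^ 2 * N * ε

/-- On the good event the residual of the true parameters is nearly orthogonal to the design. -/
theorem GoodEvent.abs_residual_le {u : ℕ → Fin p → ℝ} {w : ℕ → Fin n → ℝ}
    {v : ℕ → Fin m → ℝ} {σu σw σv ε l : ℝ} (hg : GoodEvent T N sys u w v c ρ σu σw σv ε l)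
    (hs : sys.IsStable c ρ) (hT : 0 < T) (hσu : 0 < σu) (hσw : 0 ≤ σw) (hσv : 0 ≤ σv)
    (hε : 0 < ε) (hl : 0 < l) (hN : 8 * l ≤ N) (hTε : c ^ 3 * ρ ^ (T - 1) / (1 - ρ) ≤ ε)
    (i : Fin m) (a : Fin T × Fin p) :
    |∑ r : Fin N, (sys.output u w v (T - 1 + r) i
        - ∑ q : Fin T × Fin p, sys.markov q.1 i q.2 * stackedInput T u (T - 1 + r) q)
          * stackedInput T u (T - 1 + r) a|
      ≤ N * (2 * residualScale N c ρ σu σw σv ε l + 3 * σu ^ 2 * ε) := by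
  have hN0 : (0 : ℝ) < N := by linarith
  have hρ : 0 < 1 - ρ := by linarith [hs.lt_one]
  have hsum := (abs_gram_sub_le (fun r : Fin N => stackedInput T u (T - 1 + r)) (fun q => q.1)
    hσu hl hN hg.gram_diag hg.gram_offDiag).1 a
  set φ : Fin N → ℝ := fun r => stackedInput T u (T - 1 + r) a with hφ
  have hφ0 : 0 ≤ ∑ r, φ r ^ 2 := Finset.sum_nonneg fun _ _ => sq_nonneg _
  obtain ⟨hn1, hn2⟩ := noiseKernel_bounds hs T N i
  obtain ⟨ht1, ht2⟩ := tailKernel_bounds hs hT N i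
  have hΓ : 0 ≤ c ^ 2 / (1 - ρ) := by positivity
  have hτw : 0 ≤ effNoise c ρ σw := by unfold effNoise; positivity
  have hV : σw ^ 2 * ∑ s, (∑ r, noiseKernel T N sys i r s * φ r) ^ 2 + σv ^ 2 * ∑ r, φ r ^ 2
      ≤ (effNoise c ρ σw + σv) ^ 2 * (2 * N * σu ^ 2) := by
    have h1 := sum_sq_sum_mul_le_sq_mul (fun s r => noiseKernel T N sys i r s) φ hΓ hn2 hn1
    calc _ ≤ σw ^ 2 * ((c ^ 2 / (1 - ρ)) ^ 2 * ∑ r, φ r ^ 2) + σv ^ 2 * ∑ r, φ r ^ 2 := by gcongr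
      _ = (effNoise c ρ σw ^ 2 + σv ^ 2) * ∑ r, φ r ^ 2 := by unfold effNoise; ring
      _ ≤ (effNoise c ρ σw + σv) ^ 2 * (2 * N * σu ^ 2) := by
        gcongr
        nlinarith [mul_nonneg hτw hσv]
  have hnoise := (hg.noise i a).le.trans (selfNormalized_threshold_le hN0 hσu
    (add_nonneg hτw hσv) hl hε hV rfl)
  have htail : |∑ r : Fin N, (∑ s, tailKernel T N sys i r s * u s.1 s.2) * φ r|
      ≤ N * (3 * σu ^ 2 * ε) := by
    refine abs_sum_mul_le_of_tail _ φ hN0.le hε.le ?_ hsum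
    refine (sum_sq_sum_mul_le (fun r s => tailKernel T N sys i r s) (fun s => u s.1 s.2)
      (fun r => (ht1 r).trans hTε)).trans ?_
    exact mul_le_mul_of_nonneg_left (hg.tail i).le hε.le
  have hsplit : ∑ r : Fin N, (sys.output u w v (T - 1 + r) i
        - ∑ q : Fin T × Fin p, sys.markov q.1 i q.2 * stackedInput T u (T - 1 + r) q) * φ r
      = ∑ r : Fin N, (∑ s, tailKernel T N sys i r s * u s.1 s.2) * φ r
        + ∑ r : Fin N, (∑ s, noiseKernel T N sys i r s * w s.1 s.2 + v (T - 1 + r) i) * φ r := by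
    rw [← Finset.sum_add_distrib]
    refine Finset.sum_congr rfl fun r _ => ?_
    rw [LinSys.output_sub_eq sys hT, ← add_mul]
    rfl
  rw [hsplit]
  refine (abs_add_le _ _).trans ?_
  linarith

theorem GoodEvent.errorBounds {u : ℕ → Fin p → ℝ} {w : ℕ → Fin n → ℝ}
    {v : ℕ → Fin m → ℝ} {σu σw σv ε l : ℝ} (hg : GoodEvent T N sys u w v c ρ σu σw σv ε l)
    (hs : sys.IsStable c ρ) (hT : 0 < T) (hσu : 0 < σu) (hσw : 0 ≤ σw) (hσv : 0 ≤ σv)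
    (hε : 0 < ε) (hl : 0 < l) (hN : 8 * l ≤ N) (hTε : c ^ 3 * ρ ^ (T - 1) / (1 - ρ) ≤ ε)
    {lam b : ℝ} (hlam : 2 * (2 * residualScale N c ρ σu σw σv ε l + 3 * σu ^ 2 * ε) ≤ lam)
    (hb : 0 ≤ b)
    (hb2 : 6 * (lam * (c ^ 3 / (1 - ρ)) / σu ^ 2) + 192 * √(l / N) * (c ^ 3 / (1 - ρ)) ^ 2
      + 2 * (maxRowSum sys.C * c ^ 2 * ρ ^ (T - 1) / (1 - ρ)) ^ 2 ≤ b ^ 2)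
    {X : Matrix (Fin m) (Fin T × Fin p) ℝ}
    (hX : IsLassoEstimate T N lam u (sys.output u w v) X) (K : ℕ∞) : ErrorBounds sys X K b := by
  have hN0 : (0 : ℝ) < N := by linarith
  have hN0' : 0 < N := by exact_mod_cast hN0
  have hρ : 0 < 1 - ρ := by linarith [hs.lt_one]
  have hc := hs.one_le
  have hlam0 : 0 < lam := by
    have h1 : 0 ≤ effNoise c ρ σw := by unfold effNoise; positivity
    have h2 : 0 < residualScale N c ρ σu σw σv ε l := by unfold residualScale; positivity
    have h3 : 0 < 3 * σu ^ 2 * ε := by positivity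
    linarith
  have ha : 0 ≤ 6 * (lam * (c ^ 3 / (1 - ρ)) / σu ^ 2)
      + 192 * √(l / N) * (c ^ 3 / (1 - ρ)) ^ 2 := by positivity
  refine errorBounds_of_rowErr hT (a := √(6 * (lam * (c ^ 3 / (1 - ρ)) / σu ^ 2)
      + 192 * √(l / N) * (c ^ 3 / (1 - ρ)) ^ 2)) hs.rate_nonneg hs.lt_one hb (fun i => ?_)
      (fun i k => rowErr_tail_le hs hT X i k) (by rwa [Real.sq_sqrt ha]) K
  rw [sum_rowErr_eq, Real.sq_sqrt ha]
  refine ENNReal.ofReal_le_ofReal ?_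
  have h1 := lasso_slow_rate (fun r : Fin N => stackedInput T u (T - 1 + r))
    (fun r : Fin N => sys.output u w v (T - 1 + r) i)
    (fun q => sys.markov q.1 i q.2) (X i) (M := N) (lam := lam) (V := σu ^ 2)
    (δ := 3 * σu ^ 2 * √(l / N)) (G := 2 * (c ^ 3 / (1 - ρ))) hN0 hlam0 (by positivity)
    (hX.row hT hN0' i _)
    (fun q => (hg.abs_residual_le hs hT hσu hσw hσv hε hl hN hTε i q).trans (by
      gcongr; linarith))
    (abs_gram_sub_le (fun r : Fin N => stackedInput T u (T - 1 + r)) (fun q => q.1)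
      hσu hl hN hg.gram_diag hg.gram_offDiag).2 (hs.sum_abs_markov_le T i)
  have hσ2 : 0 < σu ^ 2 := by positivity
  refine le_of_mul_le_mul_left (h1.trans (le_of_eq ?_)) hσ2
  field_simp
  ring

end Assembly

section Probability

theorem measure_iUnion_le_card_mul {Ω κ : Type*} [MeasurableSpace Ω]
    {μ : Measure Ω} [Fintype κ] (B : κ → Set Ω) {E : ℝ≥0∞}
    (h : ∀ a, μ (B a) ≤ E) : μ (⋃ a, B a) ≤ Fintype.card κ * E := by
  refine (measure_iUnion_fintype_le μ B).trans ((Finset.sum_le_sum fun a _ => h a).trans ?_)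
  simp

variable {n p m T N : ℕ} {Ω : Type*} [MeasurableSpace Ω] {μ : Measure Ω} [IsProbabilityMeasure μ]
  {u : ℕ → Ω → Fin p → ℝ} {w : ℕ → Ω → Fin n → ℝ} {v : ℕ → Ω → Fin m → ℝ} {σu σw σv : ℝ≥0}
  {sys : LinSys n p m} {c ρ : ℝ}

/-- The union bound over `T p` columns, `(T p)²` pairs of columns, `m T p` pairs of an output and
a column, and `m` outputs. -/
theorem LTI.IsNoiseModel.measure_not_goodEvent_le
    (h : IsNoiseModel μ (T + N - 1) u w v σu σw σv) (hs : sys.IsStable c ρ) (hT : 0 < T)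
    (hσu : 0 < σu) {ε l : ℝ} (hε : 0 < ε) (hl : 0 < l) (hN : 8 * l ≤ N)
    (hTε : c ^ 3 * ρ ^ (T - 1) / (1 - ρ) ≤ ε) :
    μ {ω | ¬ GoodEvent T N sys (fun t => u t ω) (fun t => w t ω) (fun t => v t ω)
        c ρ σu σw σv ε l}
      ≤ ((2 * (T * p) + 2 * (T * p) ^ 2 + 2 * m * (T * p) + m : ℕ) : ℝ≥0∞)
        * ENNReal.ofReal (Real.exp (-l)) := by
  have hN0 : (0 : ℝ) < N := by linarith
  have hρ : 0 < 1 - ρ := by linarith [hs.lt_one]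
  have hσ' : (0 : ℝ) < σu := by exact_mod_cast hσu
  set E := ENNReal.ofReal (Real.exp (-l)) with hE
  have hR : 0 < residualScale N c ρ σu σw σv ε l := by
    have h1 : 0 ≤ effNoise c ρ σw := by unfold effNoise; positivity
    unfold residualScale; positivity
  have hD := measure_iUnion_le_card_mul _ (fun a : Fin T × Fin p => h.measure_gram_diag_le hσu
    (q := √(8 * l / N)) (l := l) (Real.sqrt_nonneg _)
    (by rw [Real.sqrt_le_one]; exact (div_le_one hN0).2 hN)
    (by rw [Real.sq_sqrt (by positivity)]; field_simp; exact le_rfl) a)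
  have hO := measure_iUnion_le_card_mul (μ := μ) (E := 2 * E)
    (fun ab : (Fin T × Fin p) × (Fin T × Fin p) => {ω | (ab.1.1 ≤ ab.2.1 ∧ ab.1 ≠ ab.2) ∧
      l / (√(l / N) / (σu : ℝ) ^ 2) + √(l / N) / (σu : ℝ) ^ 2 / 2 *
          ∑ r : Fin N, (σu : ℝ) ^ 2 * stackedInput T (fun t => u t ω) (T - 1 + r) ab.2 ^ 2
        ≤ |∑ r : Fin N, stackedInput T (fun t => u t ω) (T - 1 + r) ab.2
            * stackedInput T (fun t => u t ω) (T - 1 + r) ab.1|}) (fun ab => by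
      by_cases hab : ab.1.1 ≤ ab.2.1 ∧ ab.1 ≠ ab.2
      · simp only [hab, true_and, ne_eq, not_false_eq_true]
        exact h.measure_gram_offDiag_le (by positivity) hab.1 hab.2
      · simp [hab])
  have hW := measure_iUnion_le_card_mul _ (fun ia : Fin m × (Fin T × Fin p) =>
    h.measure_noise_le (l := l) (θ := l / (N * residualScale N c ρ σu σw σv ε l))
      (by positivity) (noiseKernel T N sys ia.1) ia.1 ia.2)
  have hL := measure_iUnion_le_card_mul _ (fun i : Fin m =>
    (h.measure_tail_le hσu (tailKernel T N sys i) hε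
      (fun r => ((tailKernel_bounds hs hT N i).1 r).trans hTε)
      (fun s => ((tailKernel_bounds hs hT N i).2 s).trans hTε)).trans
      (ENNReal.ofReal_le_ofReal (Real.exp_le_exp.2 (by linarith : -(3 * (N : ℝ) / 8) ≤ -l))))
  refine (measure_mono ?_).trans (((measure_union_le _ _).trans (add_le_add
    ((measure_union_le _ _).trans (add_le_add ((measure_union_le _ _).trans
      (add_le_add hD hO)) hW)) hL)).trans (le_of_eq ?_))
  · intro ω hω
    by_contra hcon
    simp only [Set.mem_union, Set.mem_iUnion, Set.mem_ofPred_eq, not_or, not_exists, not_and,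
      not_le] at hcon
    obtain ⟨⟨⟨h1, h2⟩, h3⟩, h4⟩ := hcon
    exact hω ⟨h1, fun a b hab hne => h2 (a, b) ⟨hab, hne⟩, fun i a => h3 (i, a), h4⟩
  · simp only [Fintype.card_prod, Fintype.card_fin]
    push_cast
    ring

end Probability

/-- With `l = (η + 5) log Q`, the number of events, at most `m Q⁵` for `Q ≥ 2`, is absorbed. -/
theorem union_bound_rate {Q m : ℕ} (hQ : 2 ≤ Q) (hm : 0 < m) (η : ℝ) :
    ((2 * Q + 2 * Q ^ 2 + 2 * m * Q + m : ℕ) : ℝ≥0∞)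
        * ENNReal.ofReal (Real.exp (-((η + 5) * Real.log Q)))
      ≤ ENNReal.ofReal (m * (Q : ℝ) ^ (-η)) := by
  have hQ0 : (0 : ℝ) < Q := by exact_mod_cast (by omega : 0 < Q)
  have h1 : 2 * Q + 2 * Q ^ 2 + 2 * m * Q + m ≤ m * Q ^ 5 := by
    have e0 : 2 * Q ≤ Q ^ 2 := by nlinarith
    have e1 : Q ^ 2 ≤ m * Q ^ 2 := Nat.le_mul_of_pos_left _ hm
    have e2 : 2 * m * Q ≤ m * Q ^ 2 := by nlinarith
    have e3 : m ≤ m * Q ^ 2 := Nat.le_mul_of_pos_right _ (by positivity)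
    have e4 : 8 ≤ Q ^ 3 := by
      calc 8 = 2 ^ 3 := by norm_num
        _ ≤ Q ^ 3 := Nat.pow_le_pow_left hQ 3
    have e5 : m * Q ^ 5 = (m * Q ^ 2) * Q ^ 3 := by ring
    have e6 : (m * Q ^ 2) * 8 ≤ (m * Q ^ 2) * Q ^ 3 := Nat.mul_le_mul_left _ e4
    omega
  rw [← ENNReal.ofReal_natCast, ← ENNReal.ofReal_mul (by positivity)]
  refine ENNReal.ofReal_le_ofReal ?_
  have h2 : Real.exp (-((η + 5) * Real.log Q)) = (Q : ℝ) ^ (-η) * ((Q : ℝ) ^ 5)⁻¹ := by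
    rw [Real.rpow_def_of_pos hQ0, ← Real.exp_log (pow_pos hQ0 5), ← Real.exp_neg, ← Real.exp_add,
      Real.log_pow]
    congr 1; push_cast; ring
  calc _ ≤ ((m * Q ^ 5 : ℕ) : ℝ) * ((Q : ℝ) ^ (-η) * ((Q : ℝ) ^ 5)⁻¹) := by
        rw [h2]; gcongr
    _ = _ := by push_cast; field_simp

/-! ### Choice of the constants -/

theorem mainTheorem2 (η : ℝ) (hη : 0 < η) (S : ℝ) (hS : 0 < S) :
    ∃ c₁ c₂ c₃ : ℝ, 0 < c₁ ∧ 0 < c₂ ∧ 0 < c₃ ∧ ∀ c₄ : ℝ, c₃ ≤ c₄ → ∃ c₅ : ℝ, 0 < c₅ ∧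
      ∀ (n p m T N : ℕ), 0 < n → 0 < p → 0 < m → 0 < T → 0 < N →
      ∀ (sys : LinSys n p m) (Csys ρ : ℝ), sys.IsStable Csys ρ →
      ∀ (σu σw σv : ℝ≥0), 0 < σu → (σu : ℝ) ≤ S →
      ∀ (Ω : Type*) [MeasurableSpace Ω] (μ : Measure Ω) [IsProbabilityMeasure μ]
        (u : ℕ → Ω → Fin p → ℝ) (w : ℕ → Ω → Fin n → ℝ) (v : ℕ → Ω → Fin m → ℝ),
      IsNoiseModel μ (T + N - 1) u w v σu σw σv →
      ∀ (ε ε' lam : ℝ), 0 < ε → 0 < ε' →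
      c₁ * Real.log (T * p) ^ 2 ≤ N →
      c₂ * max (T₀ n p T N Csys ρ σw σv ε)
        (Real.log (maxRowSum sys.C / ε') / (1 - ρ)) ≤ T →
      c₃ * lambdaScale n p T N Csys ρ σu σw σv ε ≤ lam →
      lam ≤ c₄ * lambdaScale n p T N Csys ρ σu σw σv ε →
      μ {ω | ¬ ∀ X : Matrix (Fin m) (Fin T × Fin p) ℝ,
          IsLassoEstimate T N lam (fun t => u t ω)
            (sys.output (fun t => u t ω) (fun t => w t ω) (fun t => v t ω)) X →
          ∀ K : ℕ∞, (T : ℕ∞) ≤ K →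
            ErrorBounds sys X K
              (c₅ * (max (err₁ n p T N Csys ρ σu σw σv ε) (err₂ p T N Csys ρ) + ε'))}
        ≤ ENNReal.ofReal (m * ((T : ℝ) * p) ^ (-η)) := by
  have hη' : 0 < η + 5 := by linarith
  -- `c₁` gives `8 l ≤ N` for `l = (η + 5) log (T p)`; `c₂` makes `ρ ^ (T - 1)` negligible against
  -- the factors in `T₀` and forces `T ≥ 2`; `c₃` makes `λ / 2` exceed the correlation between
  -- residuals and inputs on the good event
  refine ⟨16 * (η + 5), 12 + 2 / Real.log (Real.log 3), 4 * (1 + √(η + 5)) + 6 * S ^ 2,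
    by positivity, ?_, by positivity, ?_⟩
  · have := Real.log_pos one_lt_log_three
    positivity
  intro c₄ hc₄
  have hc₄0 : 0 ≤ c₄ := le_trans (by positivity) hc₄
  refine ⟨6 * c₄ * S ^ 2 + 192 * √(η + 5) + 2, by positivity, ?_⟩
  intro n p m T N hn hp hm hT hN sys Csys ρ hs σu σw σv hσu hσS Ω _ μ _ u w v hmodel ε ε' lam hε hε'
    hN1 hT1 hlam1 hlam2
  have hQ : 0 < T * p := Nat.mul_pos hT hp
  rcases Nat.lt_or_ge (T * p) 2 with hQ1 | hQ2
  -- for `T p = 1` the asserted probability bound is `m ≥ 1`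
  · have e : (T : ℝ) * p = 1 := by exact_mod_cast (by omega : T * p = 1)
    rw [e, Real.one_rpow, mul_one]
    refine prob_le_one.trans ?_
    rw [← ENNReal.ofReal_one]
    exact ENNReal.ofReal_le_ofReal (by exact_mod_cast hm)
  have hc := hs.one_le
  have hρ : 0 < 1 - ρ := by linarith [hs.lt_one]
  have hσ' : (0 : ℝ) < σu := by exact_mod_cast hσu
  obtain ⟨-, hTε, hTε'⟩ := memory_length_bounds hn hN hQ2 hc hs.rate_nonneg hs.lt_one hε hε'
    (maxRowSum_nonneg sys.C) hT1
  have hlog2 : 1 / 2 ≤ Real.log (T * p) := by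
    have h1 : (2 : ℝ) ≤ T * p := by exact_mod_cast hQ2
    have h2 := Real.log_le_log (by norm_num) h1
    linarith [Real.log_two_gt_d9]
  have hlogn : Real.log (T * p) ≤ Real.log (T * p * n) := by
    refine Real.log_le_log (by exact_mod_cast hQ) ?_
    have : (1 : ℝ) ≤ n := by exact_mod_cast hn
    exact le_mul_of_one_le_right (by positivity) this
  set l := (η + 5) * Real.log (T * p) with hl
  have hl0 : 0 < l := by positivity
  have hN0 : (0 : ℝ) < N := by exact_mod_cast hN
  have hNl : 8 * l ≤ N := by
    refine le_trans ?_ hN1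
    have : (η + 5) * Real.log (T * p) * (1 / 2)
        ≤ (η + 5) * Real.log (T * p) * Real.log (T * p) := by
      gcongr
    rw [hl]; linarith
  set Λ := lambdaScale n p T N Csys ρ σu σw σv ε with hΛ
  have hτ : 0 ≤ effNoise Csys ρ σw + σv := by unfold effNoise; positivity
  have hΛε : ε ≤ Λ := by
    rw [hΛ, lambdaScale]
    have : 0 ≤ (σu : ℝ) * (effNoise Csys ρ σw + σv) * √(Real.log (T * p * n) / N) := by positivity
    linarith
  have hR : residualScale N Csys ρ σu σw σv ε l ≤ (1 + √(η + 5)) * Λ := by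
    have h1 : √(l / N) ≤ √(η + 5) * √(Real.log (T * p * n) / N) := by
      rw [← Real.sqrt_mul (by positivity), hl, mul_div_assoc]
      gcongr
    have h2 : (σu : ℝ) * (effNoise Csys ρ σw + σv) * √(l / N)
        ≤ √(η + 5) * (σu * (effNoise Csys ρ σw + σv) * √(Real.log (T * p * n) / N)) := by
      calc _ ≤ (σu : ℝ) * (effNoise Csys ρ σw + σv)
            * (√(η + 5) * √(Real.log (T * p * n) / N)) := by gcongr
        _ = _ := by ring
    have h3 : (σu : ℝ) * (effNoise Csys ρ σw + σv) * √(Real.log (T * p * n) / N) ≤ Λ := by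
      rw [hΛ, lambdaScale]; linarith
    have h4 := mul_le_mul_of_nonneg_left h3 (Real.sqrt_nonneg (η + 5))
    rw [residualScale]
    linarith
  have hlam : 2 * (2 * residualScale N Csys ρ σu σw σv ε l + 3 * σu ^ 2 * ε) ≤ lam := by
    have h1 : 3 * (σu : ℝ) ^ 2 * ε ≤ 3 * S ^ 2 * Λ := by gcongr
    linarith
  set e₁ := err₁ n p T N Csys ρ σu σw σv ε with he₁
  set e₂ := err₂ p T N Csys ρ with he₂
  have he₁0 : 0 ≤ e₁ := by
    rw [he₁, err₁]
    have : 0 ≤ Real.log (T * p * n) := by linarith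
    positivity
  have he₂0 : 0 ≤ e₂ := by
    rw [he₂, err₂]
    have : 0 ≤ Real.log (T * p) := by linarith
    positivity
  have hbound : 6 * (lam * (Csys ^ 3 / (1 - ρ)) / σu ^ 2)
      + 192 * √(l / N) * (Csys ^ 3 / (1 - ρ)) ^ 2
      + 2 * (maxRowSum sys.C * Csys ^ 2 * ρ ^ (T - 1) / (1 - ρ)) ^ 2
      ≤ ((6 * c₄ * S ^ 2 + 192 * √(η + 5) + 2) * (max e₁ e₂ + ε')) ^ 2 := by
    have h1 : lam * (Csys ^ 3 / (1 - ρ)) / σu ^ 2 ≤ c₄ * (S ^ 2 * e₁ ^ 2) := by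
      calc _ ≤ c₄ * Λ * (Csys ^ 3 / (1 - ρ)) / σu ^ 2 := by gcongr
        _ = c₄ * (Csys ^ 3 / (1 - ρ) * Λ / σu ^ 2) := by ring
        _ ≤ _ := by
          gcongr
          exact lambdaScale_le_err₁_sq (by linarith) hs.lt_one hσ' hσS σw.2 σv.2 hε.le
            (by linarith)
    have h2 : √(l / N) * (Csys ^ 3 / (1 - ρ)) ^ 2 = √(η + 5) * e₂ ^ 2 := by
      rw [he₂, err₂_sq (by linarith), hl, mul_div_assoc, Real.sqrt_mul (by positivity)]
      ring
    have h3 : (maxRowSum sys.C * Csys ^ 2 * ρ ^ (T - 1) / (1 - ρ)) ^ 2 ≤ ε' ^ 2 := by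
      refine pow_le_pow_left₀ (div_nonneg (mul_nonneg (mul_nonneg (maxRowSum_nonneg _)
        (by positivity)) (pow_nonneg hs.rate_nonneg _)) hρ.le) hTε' 2
    have h4 : e₁ ^ 2 ≤ (max e₁ e₂ + ε') ^ 2 :=
      pow_le_pow_left₀ he₁0 (by linarith [le_max_left e₁ e₂]) 2
    have h5 : e₂ ^ 2 ≤ (max e₁ e₂ + ε') ^ 2 :=
      pow_le_pow_left₀ he₂0 (by linarith [le_max_right e₁ e₂]) 2
    have h6 : ε' ^ 2 ≤ (max e₁ e₂ + ε') ^ 2 :=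
      pow_le_pow_left₀ hε'.le (by linarith [le_max_left e₁ e₂]) 2
    set M := (max e₁ e₂ + ε') ^ 2
    set κ := 6 * c₄ * S ^ 2 + 192 * √(η + 5) + 2 with hκ
    have hM : 0 ≤ M := sq_nonneg _
    have hκ1 : 1 ≤ κ := by
      have : 0 ≤ 6 * c₄ * S ^ 2 + 192 * √(η + 5) := by positivity
      linarith
    calc _ ≤ 6 * (c₄ * (S ^ 2 * M)) + 192 * (√(η + 5) * M) + 2 * M := by
          rw [mul_assoc 192, h2]
          have := h1.trans (by gcongr : c₄ * (S ^ 2 * e₁ ^ 2) ≤ c₄ * (S ^ 2 * M))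
          have := h3.trans h6
          gcongr
      _ = κ * M := by rw [hκ]; ring
      _ ≤ κ ^ 2 * M := by
          gcongr
          exact le_self_pow₀ hκ1 two_ne_zero
      _ = _ := by rw [mul_pow]
  refine (measure_mono fun ω hω => ?_).trans ((hmodel.measure_not_goodEvent_le hs hT hσu hε hl0 hNl
    hTε).trans ?_)
  · refine fun hgood => hω fun X hX K _ => ?_
    exact hgood.errorBounds hs hT hσ' σw.2 σv.2 hε hl0 hNl hTε hlam
      (mul_nonneg (by positivity) (by positivity)) hbound hX K
  · have := union_bound_rate hQ2 hm η
    simpa only [hl, Nat.cast_mul] using this
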